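/- Let $k$ be a field and let $Q=(Q_0,Q_1,s,t)$ be a finite quiver whose underlying graph is a Dynkin diagram $A_n$ ($n\ge 1$), $D_n$ ($n\ge 4$), $E_6$, $E_7$ or $E_8$. Representations $X=(X_i,X_\alpha)$ of $Q$ over $k$ are finite dimensional; for a vertex $i$ let $P(i)$ be the representation with $P(i)_j=k[Q(i,j)]$, the vector space with basis the set $Q(i,j)$ of paths from $i$ to $j$, on which an arrow acts by composition of paths. Fix an admissible ordering $i_1,\dots,i_n$ of the vertices (each $i_p$ is a sink of $\sigma_{i_{p-1}}\cdots\sigma_{i_1}Q$, where $\sigma_i$ reverses all arrows at $i$), and let $C^+=S^+_{i_n}\cdots S^+_{i_1}$ and $C^-=S^-_{i_1}\cdots S^-_{i_n}$ be the Coxeter functors, composed of the Bernstein–Gelfand–Ponomarev reflection functors. For $r\in\mathbb Z$ put $C^r=(C^+)^r$ if $r\ge 0$ and $C^r=(C^-)^{-r}$ if $r<0$. A morphism $\phi$ is irreducible if it is neither a split monomorphism nor a split epimorphism and if, for every factorisation $\phi=\phi''\phi'$, $\phi'$ is a split monomorphism or $\phi''$ is a split epimorphism. The radical $\operatorname{Rad}(X,Y)$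 is the set of all $\phi\in\operatorname{Hom}(X,Y)$ such that $\tau\phi\sigma$ is not invertible for all indecomposable $Z$ and all $\sigma\colon Z\to X$, $\tau\colon Y\to Z$. Let $\operatorname{Rad}^0(X,Y)=\operatorname{Hom}(X,Y)$, and for $n>0$ let $\operatorname{Rad}^n(X,Y)$ be the set of all composites $\phi''\phi'$ with $\phi'\in\operatorname{Rad}(X,Z)$ and $\phi''\in\operatorname{Rad}^{n-1}(Z,Y)$ for some representation $Z$. Let $X\cong C^rP(i)$ and $Y\cong C^sP(j)$ be two indecomposable representations of $Q$, where $i,j\in Q_0$ and $r,s\in\mathbb Z$. Then: 1. $\operatorname{End}(X)\cong k$ as $k$-algebras, and every morphism $X\to Y$ that is not an isomorphism is a finite (possibly empty) sum of compositions of irreducible morphisms between indecomposable representations. 2. There exists an irreducible morphism $X\to Y$ if and only if either $r=s$ and there exists an arrow $j\to i$ in $Q$, or $r=s+1$ and there exists an arrow $i\to j$ in $Q$. For any two irreducible morphisms $\phi,\phi'\colon X\to Y$ there exists $\lambda\in k$ with $\phi'=\lambda\phi$. 3. There exists an integer $d=d(X,Y)\ge 0$ such that $$\operatorname{Hom}(X,Y)=\operatorname{Rad}^0(X,Y)=\dots=\operatorname{Rad}^d(X,Y)\supseteq\operatorname{Rad}^{d+1}(X,Y)=0.$$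 -/

import Mathlib

open CategoryTheory

namespace QuivRep

/-! ### Quivers -/

/-- A quiver with vertices `V` and arrows `A`; an arrow `α` starts at `s α` and ends at `t α`. -/
@[ext]
structure FinQuiver (V A : Type) where
  s : A → V
  t : A → V

namespace FinQuiver

variable {V A : Type}

/-- Paths of `Q` starting at `i`: `nil` is the trivial path and `cons α p` is `p` followed by the
arrow `α`. -/
inductive Path (Q : FinQuiver V A) (i : V) : V → Type
  | nil : Path Q i i
  | cons (α : A) (p : Path Q i (Q.s α)) : Path Q i (Q.t α)

def IsSink (Q : FinQuiver V A) (i : V) : Prop := ∀ α, Q.s α ≠ i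

def IsSource (Q : FinQuiver V A) (i : V) : Prop := ∀ α, Q.t α ≠ i

variable [DecidableEq V]

/-- `σ_i Q`: reverse all arrows which start or end at `i`. -/
def reflect (Q : FinQuiver V A) (i : V) : FinQuiver V A where
  s α := if Q.s α = i ∨ Q.t α = i then Q.t α else Q.s α
  t α := if Q.s α = i ∨ Q.t α = i then Q.s α else Q.t α

/-- `σ_{i_n} ⋯ σ_{i_1} Q` for the list `[i_1, …, i_n]`. -/
def reflectList (Q : FinQuiver V A) : List V → FinQuiver V A
  | [] => Q
  | i :: L => (Q.reflect i).reflectList L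

/-- Each `i_p` is a sink of `σ_{i_{p-1}} ⋯ σ_{i_1} Q`. -/
def SinkSequence (Q : FinQuiver V A) : List V → Prop
  | [] => True
  | i :: L => Q.IsSink i ∧ (Q.reflect i).SinkSequence L

/-- An admissible ordering of the vertices: a list in which each vertex occurs exactly once and
whose `p`-th entry `i_p` is a sink of `σ_{i_{p-1}} ⋯ σ_{i_1} Q`. -/
structure IsAdmissible (Q : FinQuiver V A) (L : List V) : Prop where
  nodup : L.Nodup
  mem : ∀ i, i ∈ L
  sinks : Q.SinkSequence L

theorem reflect_reflect (Q : FinQuiver V A) (i : V) : (Q.reflect i).reflect i = Q := by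
  ext α <;> simp only [reflect] <;> split_ifs <;> grind

theorem IsSink.isSource_reflect {Q : FinQuiver V A} {i : V} (h : Q.IsSink i) :
    (Q.reflect i).IsSource i := by
  intro α
  have := h α
  simp only [reflect]
  split_ifs <;> grind

theorem reflectList_apply (L : List V) (hL : L.Nodup) (Q : FinQuiver V A) (α : A) :
    (Q.reflectList L).s α = (if (Q.s α ∈ L ↔ Q.t α ∈ L) then Q.s α else Q.t α) ∧
    (Q.reflectList L).t α = (if (Q.s α ∈ L ↔ Q.t α ∈ L) then Q.t α else Q.s α) := by
  induction L generalizing Q with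
  | nil => simp [reflectList]
  | cons i L ih =>
    rw [List.nodup_cons] at hL
    have h := ih hL.2 (Q.reflect i)
    rw [reflectList, h.1, h.2]
    simp only [reflect, List.mem_cons]
    grind

theorem IsAdmissible.reflectList_eq {Q : FinQuiver V A} {L : List V} (h : Q.IsAdmissible L) :
    Q.reflectList L = Q := by
  ext α
  · simp [(reflectList_apply L h.nodup Q α).1, h.mem]
  · simp [(reflectList_apply L h.nodup Q α).2, h.mem]

end FinQuiver

/-! ### Dynkin diagrams -/

/-- The graph on `0, …, n - 1` consisting of the path `0 — 1 — ⋯ — (n - 2)` and a further vertex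
`n - 1` joined to the vertex `b` only. -/
def forkGraph (n b : ℕ) : SimpleGraph (Fin n) :=
  SimpleGraph.fromRel fun i j =>
    (i.val + 1 = j.val ∧ j.val + 1 < n) ∨ (i.val = b ∧ j.val + 1 = n)

/-- The list of Dynkin diagrams `A_n` (`n ≥ 1`), `D_n` (`n ≥ 4`), `E_6`, `E_7`, `E_8`. -/
inductive IsDynkinDiagram : (n : ℕ) → SimpleGraph (Fin n) → Prop
  | A (n : ℕ) (hn : 1 ≤ n) : IsDynkinDiagram n (SimpleGraph.pathGraph n)
  | D (n : ℕ) (hn : 4 ≤ n) : IsDynkinDiagram n (forkGraph n (n - 3))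
  | E6 : IsDynkinDiagram 6 (forkGraph 6 2)
  | E7 : IsDynkinDiagram 7 (forkGraph 7 2)
  | E8 : IsDynkinDiagram 8 (forkGraph 8 2)

/-- The underlying graph of `Q` is, up to a renaming of the vertices, a Dynkin diagram: every arrow
joins two adjacent vertices of the diagram, and any two adjacent vertices are joined by exactly one
arrow. -/
def FinQuiver.IsDynkin {V A : Type} (Q : FinQuiver V A) : Prop :=
  ∃ (n : ℕ) (Γ : SimpleGraph (Fin n)) (e : V ≃ Fin n), IsDynkinDiagram n Γ ∧
    (∀ α, Γ.Adj (e (Q.s α)) (e (Q.t α))) ∧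
    ∀ i j, Γ.Adj (e i) (e j) →
      ∃! α, (Q.s α = i ∧ Q.t α = j) ∨ (Q.s α = j ∧ Q.t α = i)

/-! ### Representations -/

universe u

/-- A representation of `Q` over `k`, not necessarily finite dimensional. -/
structure QRep {V A : Type} (Q : FinQuiver V A) (k : Type u) [Field k] where
  sp : V → ModuleCat.{u} k
  map : ∀ α : A, sp (Q.s α) →ₗ[k] sp (Q.t α)

noncomputable section

namespace QRep

variable {V A : Type} {Q Q' : FinQuiver V A} {k : Type u} [Field k]

/-- The vector space of morphisms `X → Y`. -/
def homSubmodule (X Y : QRep Q k) : Submodule k (∀ i, X.sp i →ₗ[k] Y.sp i) where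
  carrier := {φ | ∀ α, Y.map α ∘ₗ φ (Q.s α) = φ (Q.t α) ∘ₗ X.map α}
  add_mem' {φ ψ} hφ hψ α := by
    simp only [Pi.add_apply, LinearMap.comp_add, LinearMap.add_comp, hφ α, hψ α]
  zero_mem' α := by simp
  smul_mem' c φ hφ α := by
    simp only [Pi.smul_apply, LinearMap.comp_smul, LinearMap.smul_comp, hφ α]

instance : Category (QRep Q k) where
  Hom X Y := homSubmodule X Y
  id X := ⟨fun _ => LinearMap.id, fun _ => rfl⟩
  comp {X Y Z} φ ψ := ⟨fun i => ψ.1 i ∘ₗ φ.1 i, fun α => by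
    rw [← LinearMap.comp_assoc, ψ.2 α, LinearMap.comp_assoc, φ.2 α, LinearMap.comp_assoc]⟩

instance : Preadditive (QRep Q k) where
  homGroup X Y := inferInstanceAs (AddCommGroup (homSubmodule X Y))
  add_comp _ _ _ _ _ _ := Subtype.ext (funext fun _ => LinearMap.comp_add _ _ _)
  comp_add _ _ _ _ _ _ := Subtype.ext (funext fun _ => LinearMap.add_comp _ _ _)

instance : Linear k (QRep Q k) where
  homModule X Y := inferInstanceAs (Module k (homSubmodule X Y))
  smul_comp _ _ _ _ _ _ := Subtype.ext (funext fun _ => LinearMap.comp_smul _ _ _)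
  comp_smul _ _ _ _ _ _ := Subtype.ext (funext fun _ => LinearMap.smul_comp _ _ _)

def FinDim (X : QRep Q k) : Prop := ∀ i, Module.Finite k (X.sp i)

/-- Every vector space of `X` is zero. -/
def IsZeroRep (X : QRep Q k) : Prop := ∀ i, Subsingleton (X.sp i)

/-- `X = X₁ ⊕ X₂`. -/
def IsDirectSum (X X₁ X₂ : QRep Q k) : Prop :=
  ∃ (ι₁ : X₁ ⟶ X) (ι₂ : X₂ ⟶ X) (π₁ : X ⟶ X₁) (π₂ : X ⟶ X₂),
    π₁ ≫ ι₁ + π₂ ≫ ι₂ = 𝟙 X ∧ ι₁ ≫ π₁ = 𝟙 X₁ ∧ ι₂ ≫ π₂ = 𝟙 X₂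

/-- Indecomposable finite dimensional representations. -/
structure IsIndec (X : QRep Q k) : Prop where
  finDim : X.FinDim
  nonzero : ¬ X.IsZeroRep
  indec : ∀ X₁ X₂ : QRep Q k, X.IsDirectSum X₁ X₂ → X₁.IsZeroRep ∨ X₂.IsZeroRep

/-! ### Radical and irreducible morphisms, in the category of finite dimensional representations -/

/-- `Rad(X, Y)`. -/
def rad (X Y : QRep Q k) : Set (X ⟶ Y) :=
  {φ | ∀ (Z : QRep Q k), Z.IsIndec → ∀ (σ : Z ⟶ X) (τ : Y ⟶ Z), ¬ IsIso (σ ≫ φ ≫ τ)}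

/-- `Rad^n(X, Y)`. -/
def radPow : ℕ → (X Y : QRep Q k) → Set (X ⟶ Y)
  | 0, _, _ => Set.univ
  | n + 1, X, Y => {φ | ∃ (Z : QRep Q k) (φ' : X ⟶ Z) (φ'' : Z ⟶ Y),
      Z.FinDim ∧ φ' ∈ rad X Z ∧ φ'' ∈ radPow n Z Y ∧ φ = φ' ≫ φ''}

structure IsIrreducible {X Y : QRep Q k} (φ : X ⟶ Y) : Prop where
  not_splitMono : ¬ IsSplitMono φ
  not_splitEpi : ¬ IsSplitEpi φ
  factor : ∀ (Z : QRep Q k), Z.FinDim → ∀ (φ' : X ⟶ Z) (φ'' : Z ⟶ Y),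
    φ = φ' ≫ φ'' → IsSplitMono φ' ∨ IsSplitEpi φ''

/-- Compositions of one or more irreducible morphisms between indecomposable representations. -/
inductive IsIrrComp : ∀ {X Y : QRep Q k}, (X ⟶ Y) → Prop
  | irr {X Y : QRep Q k} (φ : X ⟶ Y) (hX : X.IsIndec) (hY : Y.IsIndec)
      (hφ : IsIrreducible φ) : IsIrrComp φ
  | comp {X Y Z : QRep Q k} (φ : X ⟶ Y) (ψ : Y ⟶ Z)
      (hφ : IsIrrComp φ) (hψ : IsIrrComp ψ) : IsIrrComp (φ ≫ ψ)

/-- Finite sums of such compositions (the empty sum is `0`). -/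
def IsSumOfIrrComp {X Y : QRep Q k} (φ : X ⟶ Y) : Prop :=
  φ ∈ AddSubmonoid.closure {ψ : X ⟶ Y | IsIrrComp ψ}

/-! ### Projective representations -/

variable (Q k) in
/-- `P(i)`: the space at `j` has as a basis the paths from `i` to `j`. -/
def proj (i : V) : QRep Q k where
  sp j := ModuleCat.of k (Q.Path i j →₀ k)
  map α := Finsupp.lmapDomain k k (FinQuiver.Path.cons α)

/-! ### Reflection functors, on objects -/

/-- The identification of the spaces of `X` at two equal vertices. -/
def spCast (X : QRep Q k) {j l : V} (h : j = l) : X.sp j ≃ₗ[k] X.sp l :=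
  h ▸ LinearEquiv.refl k (X.sp j)

/-- The linear map of the arrow `α`, for end points given up to equality. -/
def mapOf (X : QRep Q k) (α : A) {j l : V} (hs : Q.s α = j) (ht : Q.t α = l) :
    X.sp j →ₗ[k] X.sp l :=
  (X.spCast ht).toLinearMap ∘ₗ X.map α ∘ₗ (X.spCast hs.symm).toLinearMap

/-- Representations of equal quivers are the same thing. -/
def ofEq (h : Q = Q') (X : QRep Q k) : QRep Q' k where
  sp := X.sp
  map α := X.mapOf α (by rw [h]) (by rw [h])

variable [DecidableEq V]

/-- The family of vector spaces of `X` with the one at the vertex `i` replaced by `M`. -/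
def newSp (X : QRep Q k) (i : V) (M : ModuleCat.{u} k) (j : V) : ModuleCat.{u} k :=
  if j = i then M else X.sp j

def newSpAt (X : QRep Q k) (i : V) (M : ModuleCat.{u} k) {j : V} (h : j = i) :
    X.newSp i M j ≃ₗ[k] M :=
  (show M = X.newSp i M j from (if_pos h).symm) ▸ LinearEquiv.refl k M

def newSpOff (X : QRep Q k) (i : V) (M : ModuleCat.{u} k) {j : V} (h : j ≠ i) :
    X.newSp i M j ≃ₗ[k] X.sp j :=
  (show X.sp j = X.newSp i M j from (if_neg h).symm) ▸ LinearEquiv.refl k (X.sp j)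

/-- The map `(X_α) : ⨁_{t(α) = i} X_{s(α)} → X_i`. -/
def inMap [Fintype A] (X : QRep Q k) (i : V) :
    (∀ α : {α : A // Q.t α = i}, X.sp (Q.s α)) →ₗ[k] X.sp i :=
  ∑ α : {α : A // Q.t α = i}, X.mapOf α.1 rfl α.2 ∘ₗ LinearMap.proj α

/-- The map `(X_α) : X_i → ⨁_{s(α) = i} X_{t(α)}`. -/
def outMap (X : QRep Q k) (i : V) :
    X.sp i →ₗ[k] (∀ α : {α : A // Q.s α = i}, X.sp (Q.t α)) :=
  LinearMap.pi fun α => X.mapOf α.1 α.2 rfl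

/-- `S_i^+ X` for a sink `i`: the space at `i` becomes the kernel of `inMap`, and the reversed
arrows `i → s(α)` act as the inclusion of the kernel followed by the projections. -/
def reflPlus [Fintype A] (X : QRep Q k) {i : V} (hi : Q.IsSink i) : QRep (Q.reflect i) k where
  sp := X.newSp i (ModuleCat.of k (LinearMap.ker (X.inMap i)))
  map α :=
    if h : Q.t α = i then
      (X.newSpOff i _ (by simpa [FinQuiver.reflect, h] using hi α)).symm.toLinearMap ∘ₗ
        (X.spCast (show Q.s α = (Q.reflect i).t α by simp [FinQuiver.reflect, h])).toLinearMap ∘ₗ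
        LinearMap.proj (R := k) (φ := fun β : {α : A // Q.t α = i} => X.sp (Q.s β)) ⟨α, h⟩ ∘ₗ
        (LinearMap.ker (X.inMap i)).subtype ∘ₗ
        (X.newSpAt i _ (show (Q.reflect i).s α = i by simp [FinQuiver.reflect, h])).toLinearMap
    else
      (X.newSpOff i _ (by simp [FinQuiver.reflect, h, hi α])).symm.toLinearMap ∘ₗ
        X.mapOf α (by simp [FinQuiver.reflect, h, hi α]) (by simp [FinQuiver.reflect, h, hi α]) ∘ₗ
        (X.newSpOff i _ (by simp [FinQuiver.reflect, h, hi α])).toLinearMap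

/-- `S_i^- X` for a source `i`: the space at `i` becomes the cokernel of `outMap`, and the reversed
arrows `t(α) → i` act as the inclusions into the direct sum followed by the map onto the
cokernel. -/
def reflMinus [DecidableEq A] (X : QRep Q k) {i : V} (hi : Q.IsSource i) :
    QRep (Q.reflect i) k where
  sp := X.newSp i (ModuleCat.of k
    ((∀ α : {α : A // Q.s α = i}, X.sp (Q.t α)) ⧸ LinearMap.range (X.outMap i)))
  map α :=
    if h : Q.s α = i then
      (X.newSpAt i _ (show (Q.reflect i).t α = i by simp [FinQuiver.reflect, h])).symm.toLinearMap ∘ₗ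
        (LinearMap.range (X.outMap i)).mkQ ∘ₗ
        LinearMap.single k (fun β : {α : A // Q.s α = i} => X.sp (Q.t β)) ⟨α, h⟩ ∘ₗ
        (X.spCast (show (Q.reflect i).s α = Q.t α by simp [FinQuiver.reflect, h])).toLinearMap ∘ₗ
        (X.newSpOff i _ (by simpa [FinQuiver.reflect, h] using hi α)).toLinearMap
    else
      (X.newSpOff i _ (by simp [FinQuiver.reflect, h, hi α])).symm.toLinearMap ∘ₗ
        X.mapOf α (by simp [FinQuiver.reflect, h, hi α]) (by simp [FinQuiver.reflect, h, hi α]) ∘ₗ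
        (X.newSpOff i _ (by simp [FinQuiver.reflect, h, hi α])).toLinearMap

/-! ### Coxeter functors, on objects -/

/-- `S_{i_n}^+ ⋯ S_{i_1}^+` for the list `[i_1, …, i_n]`. -/
def plusAlong [Fintype A] : (L : List V) → (Q : FinQuiver V A) → Q.SinkSequence L →
    QRep Q k → QRep (Q.reflectList L) k
  | [], _, _, X => X
  | i :: L, Q, h, X => plusAlong L (Q.reflect i) h.2 (X.reflPlus h.1)

/-- `S_{i_1}^- ⋯ S_{i_n}^-` for the list `[i_1, …, i_n]`. -/
def minusAlong [DecidableEq A] : (L : List V) → (Q : FinQuiver V A) → Q.SinkSequence L →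
    QRep (Q.reflectList L) k → QRep Q k
  | [], _, _, X => X
  | i :: L, Q, h, X =>
      ((minusAlong L (Q.reflect i) h.2 X).reflMinus h.1.isSource_reflect).ofEq
        (Q.reflect_reflect i)

/-- `C^+` with respect to an admissible ordering. -/
def coxPlus [Fintype A] {L : List V} (hL : Q.IsAdmissible L) (X : QRep Q k) : QRep Q k :=
  (plusAlong L Q hL.sinks X).ofEq hL.reflectList_eq

/-- `C^-` with respect to an admissible ordering. -/
def coxMinus [DecidableEq A] {L : List V} (hL : Q.IsAdmissible L) (X : QRep Q k) : QRep Q k :=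
  minusAlong L Q hL.sinks (X.ofEq hL.reflectList_eq.symm)

/-- `C^r` for `r ∈ ℤ`: `(C^+)^r` for `r ≥ 0` and `(C^-)^{-r}` for `r < 0`. -/
def coxPow [Fintype A] [DecidableEq A] {L : List V} (hL : Q.IsAdmissible L) :
    ℤ → QRep Q k → QRep Q k
  | .ofNat n => (coxPlus hL)^[n]
  | .negSucc n => (coxMinus hL)^[n + 1]

end QRep

end

end QuivRep

open CategoryTheory

namespace QuivRep

universe u

noncomputable section

namespace QRep

variable {V A : Type} {Q Q' : FinQuiver V A} {k : Type u} [Field k]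

/-! ### Morphisms by components -/

@[simp]
theorem mapOf_rfl (X : QRep Q k) (α : A) : X.mapOf α rfl rfl = X.map α := rfl

/-- The component of a morphism at a vertex. -/
def app {X Y : QRep Q k} (φ : X ⟶ Y) (j : V) : X.sp j →ₗ[k] Y.sp j :=
  Subtype.val (p := fun f => f ∈ homSubmodule X Y) φ j

theorem hom_ext {X Y : QRep Q k} {φ ψ : X ⟶ Y} (h : ∀ j x, app φ j x = app ψ j x) : φ = ψ :=
  Subtype.ext (funext fun j => LinearMap.ext (h j))

@[simp]
theorem app_id (X : QRep Q k) (j : V) (x : X.sp j) : app (𝟙 X) j x = x := rfl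

@[simp]
theorem app_comp {X Y Z : QRep Q k} (φ : X ⟶ Y) (ψ : Y ⟶ Z) (j : V) (x : X.sp j) :
    app (φ ≫ ψ) j x = app ψ j (app φ j x) := rfl

@[simp]
theorem app_add {X Y : QRep Q k} (φ ψ : X ⟶ Y) (j : V) (x : X.sp j) :
    app (φ + ψ) j x = app φ j x + app ψ j x := rfl

@[simp]
theorem app_zero {X Y : QRep Q k} (j : V) (x : X.sp j) : app (0 : X ⟶ Y) j x = 0 := rfl

@[simp]
theorem app_smul {X Y : QRep Q k} (c : k) (φ : X ⟶ Y) (j : V) (x : X.sp j) :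
    app (c • φ) j x = c • app φ j x := rfl

theorem app_sum {X Y : QRep Q k} {ι : Type*} (s : Finset ι) (f : ι → (X ⟶ Y)) (j : V)
    (x : X.sp j) : app (∑ t ∈ s, f t) j x = ∑ t ∈ s, app (f t) j x := by
  classical
  induction s using Finset.induction_on with
  | empty => simp
  | insert t s ht ih => rw [Finset.sum_insert ht, Finset.sum_insert ht, app_add, ih]

theorem app_mapOf {X Y : QRep Q k} (φ : X ⟶ Y) (α : A) {j l : V} (hs : Q.s α = j)
    (ht : Q.t α = l) (x : X.sp j) :
    app φ l (X.mapOf α hs ht x) = Y.mapOf α hs ht (app φ j x) := by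
  subst hs ht
  exact (LinearMap.congr_fun (Subtype.prop (p := fun f => f ∈ homSubmodule X Y) φ α) x).symm

/-- A morphism from its components. -/
def homMk {X Y : QRep Q k} (f : ∀ j, X.sp j →ₗ[k] Y.sp j)
    (hf : ∀ α x, f (Q.t α) (X.map α x) = Y.map α (f (Q.s α) x)) : X ⟶ Y :=
  ⟨f, fun α => LinearMap.ext fun x => (hf α x).symm⟩

@[simp]
theorem app_homMk {X Y : QRep Q k} (f : ∀ j, X.sp j →ₗ[k] Y.sp j)
    (hf : ∀ α x, f (Q.t α) (X.map α x) = Y.map α (f (Q.s α) x)) (j : V) :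
    app (homMk f hf) j = f j := rfl

theorem exists_family {i : V} {P : V → Type*} (g : P i) (f : ∀ j, j ≠ i → P j) :
    ∃ F : ∀ j, P j, F i = g ∧ ∀ j h, F j = f j h := by
  classical
  refine ⟨fun j => if h : j = i then h ▸ g else f j h, by simp, fun j h => by simp [h]⟩

theorem IsZeroRep.hom_from {X Y : QRep Q k} (h : X.IsZeroRep) (φ : X ⟶ Y) : φ = 0 :=
  hom_ext fun j x => by
    have := h j
    rw [Subsingleton.elim x 0, map_zero, map_zero]

theorem isZeroRep_of_id_eq_zero {X : QRep Q k} (h : 𝟙 X = 0) : X.IsZeroRep := fun j =>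
  subsingleton_of_forall_eq 0 fun x => by
    have := congrArg (fun φ => app φ j x) h
    simpa using this

theorem IsZeroRep.of_iso {X Y : QRep Q k} (h : X.IsZeroRep) (θ : X ≅ Y) : Y.IsZeroRep := by
  apply isZeroRep_of_id_eq_zero
  rw [← θ.inv_hom_id, h.hom_from θ.hom, Limits.comp_zero]

/-- The component of an isomorphism at a vertex. -/
def isoApp {X Y : QRep Q k} (θ : X ≅ Y) (j : V) : X.sp j ≃ₗ[k] Y.sp j :=
  LinearEquiv.ofLinearMap (app θ.hom j) (app θ.inv j)
    (LinearMap.ext fun x => by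
      exact congrArg (fun φ => app φ j x) θ.inv_hom_id)
    (LinearMap.ext fun x => by
      exact congrArg (fun φ => app φ j x) θ.hom_inv_id)

@[simp]
theorem isoApp_apply {X Y : QRep Q k} (θ : X ≅ Y) (j : V) (x : X.sp j) :
    isoApp θ j x = app θ.hom j x := rfl

/-! ### Direct sums -/

/-- The direct sum of two representations. -/
def sum (X Y : QRep Q k) : QRep Q k where
  sp j := ModuleCat.of k (X.sp j × Y.sp j)
  map α := LinearMap.prodMap (X.map α) (Y.map α)

theorem isDirectSum_sum (X Y : QRep Q k) : (X.sum Y).IsDirectSum X Y := by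
  refine ⟨homMk (Y := X.sum Y) (fun j => LinearMap.inl k (X.sp j) (Y.sp j)) fun α x => ?_,
    homMk (Y := X.sum Y) (fun j => LinearMap.inr k (X.sp j) (Y.sp j)) fun α x => ?_,
    homMk (X := X.sum Y) (fun j => LinearMap.fst k (X.sp j) (Y.sp j)) fun α x => rfl,
    homMk (X := X.sum Y) (fun j => LinearMap.snd k (X.sp j) (Y.sp j)) fun α x => rfl, ?_, ?_, ?_⟩
  · change _ = (X.map α x, Y.map α 0)
    rw [map_zero]; rfl
  · change _ = (X.map α 0, Y.map α x)
    rw [map_zero]; rfl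
  · refine hom_ext fun j x => ?_
    obtain ⟨a, b⟩ := x
    change (a + 0, 0 + b) = (a, b)
    simp
  · exact hom_ext fun j x => rfl
  · exact hom_ext fun j x => rfl

theorem FinDim.sum {X Y : QRep Q k} (hX : X.FinDim) (hY : Y.FinDim) : (X.sum Y).FinDim :=
  fun j => by
    have := hX j
    have := hY j
    exact inferInstanceAs (Module.Finite k (X.sp j × Y.sp j))

theorem exists_comp_eq_add {X Y Z₁ Z₂ : QRep Q k} (f₁ : X ⟶ Z₁) (g₁ : Z₁ ⟶ Y) (f₂ : X ⟶ Z₂)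
    (g₂ : Z₂ ⟶ Y) : ∃ (f : X ⟶ Z₁.sum Z₂) (g : Z₁.sum Z₂ ⟶ Y), f ≫ g = f₁ ≫ g₁ + f₂ ≫ g₂ ∧
      (∀ (W : QRep Q k) (ρ : Z₁.sum Z₂ ⟶ W), ∃ ρ₁ ρ₂, f ≫ ρ = f₁ ≫ ρ₁ + f₂ ≫ ρ₂) ∧
      ∀ (W : QRep Q k) (ρ : W ⟶ Z₁.sum Z₂), ∃ ρ₁ ρ₂, ρ ≫ g = ρ₁ ≫ g₁ + ρ₂ ≫ g₂ := by
  obtain ⟨ι₁, ι₂, π₁, π₂, h, h₁, h₂⟩ := isDirectSum_sum Z₁ Z₂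
  refine ⟨f₁ ≫ ι₁ + f₂ ≫ ι₂, π₁ ≫ g₁ + π₂ ≫ g₂, ?_,
    fun W ρ => ⟨ι₁ ≫ ρ, ι₂ ≫ ρ, by simp⟩, fun W ρ => ⟨ρ ≫ π₁, ρ ≫ π₂, by simp⟩⟩
  have cross₁ : ι₁ ≫ π₂ = 0 := by
    have : ι₁ ≫ (π₁ ≫ ι₁ + π₂ ≫ ι₂) ≫ π₂ = ι₁ ≫ π₂ := by rw [h, Category.id_comp]
    simpa [reassoc_of% h₁, h₂] using this
  have cross₂ : ι₂ ≫ π₁ = 0 := by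
    have : ι₂ ≫ (π₁ ≫ ι₁ + π₂ ≫ ι₂) ≫ π₁ = ι₂ ≫ π₁ := by rw [h, Category.id_comp]
    simpa [reassoc_of% h₂, h₁] using this
  simp [reassoc_of% h₁, reassoc_of% h₂, reassoc_of% cross₁, reassoc_of% cross₂]

/-- The zero representation. -/
def zeroRep (Q : FinQuiver V A) (k : Type u) [Field k] : QRep Q k where
  sp _ := ModuleCat.of k PUnit
  map _ := 0

theorem isZeroRep_zeroRep (Q : FinQuiver V A) (k : Type u) [Field k] :
    (zeroRep Q k).IsZeroRep := fun _ => inferInstanceAs (Subsingleton PUnit)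

/-! ### Bricks -/

/-- Nonzero representations all of whose endomorphisms are scalar. -/
structure IsBrick (X : QRep Q k) : Prop where
  nonzero : ¬ X.IsZeroRep
  scalar : ∀ φ : X ⟶ X, ∃ c : k, φ = c • 𝟙 X

theorem IsBrick.id_ne_zero {X : QRep Q k} (hX : X.IsBrick) : 𝟙 X ≠ 0 :=
  fun h => hX.nonzero (isZeroRep_of_id_eq_zero h)

theorem IsBrick.nonempty_algEquiv {X : QRep Q k} (hX : X.IsBrick) :
    Nonempty (End X ≃ₐ[k] k) := by
  have hinj : Function.Injective (Algebra.ofId k (End X)) := by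
    refine (injective_iff_map_eq_zero _).2 fun c hc => ?_
    by_contra h
    rw [Algebra.ofId_apply, Algebra.algebraMap_eq_smul_one] at hc
    exact hX.id_ne_zero ((smul_eq_zero_iff_right h).1 hc)
  refine ⟨(AlgEquiv.ofBijective (Algebra.ofId k (End X)) ⟨hinj, fun φ => ?_⟩).symm⟩
  obtain ⟨c, hc⟩ := hX.scalar φ
  exact ⟨c, by rw [Algebra.ofId_apply, Algebra.algebraMap_eq_smul_one]; exact hc.symm⟩

theorem IsBrick.isIndec {X : QRep Q k} (hX : X.IsBrick) (hf : X.FinDim) : X.IsIndec where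
  finDim := hf
  nonzero := hX.nonzero
  indec X₁ X₂ := by
    rintro ⟨ι₁, ι₂, π₁, π₂, h, h₁, h₂⟩
    obtain ⟨c, hc⟩ := hX.scalar (π₁ ≫ ι₁)
    by_cases h0 : c = 0
    · left
      apply isZeroRep_of_id_eq_zero
      calc 𝟙 X₁ = ι₁ ≫ (π₁ ≫ ι₁) ≫ π₁ := by simp [h₁]
        _ = 0 := by simp [hc, h0]
    · right
      have hsq : (π₁ ≫ ι₁) ≫ π₁ ≫ ι₁ = π₁ ≫ ι₁ := by
        rw [Category.assoc, ← Category.assoc ι₁, h₁, Category.id_comp]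
      rw [hc] at hsq
      have hc1 : π₁ ≫ ι₁ = 𝟙 X := by
        rw [hc]
        simp only [Linear.smul_comp, Category.id_comp] at hsq
        exact smul_right_injective _ h0 hsq
      have h20 : π₂ ≫ ι₂ = 0 := by simpa [hc1] using h
      apply isZeroRep_of_id_eq_zero
      calc 𝟙 X₂ = ι₂ ≫ (π₂ ≫ ι₂) ≫ π₂ := by simp [h₂]
        _ = 0 := by simp [h20]

/-! ### Radical powers -/

theorem IsIndec.id_ne_zero {X : QRep Q k} (hX : X.IsIndec) : 𝟙 X ≠ 0 :=
  fun h => hX.nonzero (isZeroRep_of_id_eq_zero h)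

theorem zero_mem_rad (X Y : QRep Q k) : (0 : X ⟶ Y) ∈ rad X Y := by
  intro Z hZ σ τ h
  apply hZ.id_ne_zero
  rw [← IsIso.hom_inv_id (σ ≫ (0 : X ⟶ Y) ≫ τ)]
  simp only [Limits.zero_comp, Limits.comp_zero]

theorem mem_rad_of_hom_eq_zero {X Y : QRep Q k} (h : ∀ ρ : Y ⟶ X, ρ = 0) (φ : X ⟶ Y) :
    φ ∈ rad X Y := by
  intro Z hZ σ τ hi
  apply hZ.id_ne_zero
  have h0 := h (τ ≫ inv (σ ≫ φ ≫ τ) ≫ σ)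
  calc 𝟙 Z = (σ ≫ φ ≫ τ) ≫ inv (σ ≫ φ ≫ τ) ≫ (σ ≫ φ ≫ τ) ≫ inv (σ ≫ φ ≫ τ) := by
        rw [IsIso.hom_inv_id, Category.comp_id, IsIso.hom_inv_id]
    _ = σ ≫ φ ≫ (τ ≫ inv (σ ≫ φ ≫ τ) ≫ σ) ≫ φ ≫ τ ≫ inv (σ ≫ φ ≫ τ) := by
        simp only [Category.assoc]
    _ = 0 := by rw [h0]; simp

theorem not_isSplitMono_of_mem_rad {X Y : QRep Q k} (hX : X.IsIndec) {φ : X ⟶ Y}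
    (hφ : φ ∈ rad X Y) : ¬ IsSplitMono φ := by
  intro h
  apply hφ X hX (𝟙 X) (retraction φ)
  rw [IsSplitMono.id, Category.comp_id]
  infer_instance

theorem comp_mem_rad {X Y Z : QRep Q k} (ψ : X ⟶ Y) {φ : Y ⟶ Z} (hφ : φ ∈ rad Y Z) :
    ψ ≫ φ ∈ rad X Z := fun W hW σ τ => by
  simpa only [Category.assoc] using hφ W hW (σ ≫ ψ) τ

theorem comp_mem_radPow {X Y Z : QRep Q k} (ψ : X ⟶ Y) {m : ℕ} {φ : Y ⟶ Z}
    (hφ : φ ∈ radPow m Y Z) : ψ ≫ φ ∈ radPow m X Z := by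
  cases m with
  | zero => trivial
  | succ m =>
    obtain ⟨W, φ', φ'', hW, h', h'', rfl⟩ := hφ
    exact ⟨W, ψ ≫ φ', φ'', hW, comp_mem_rad ψ h', h'', by simp⟩

theorem radPow_succ_subset (m : ℕ) (X Y : QRep Q k) : radPow (m + 1) X Y ⊆ radPow m X Y := by
  induction m generalizing X with
  | zero => exact Set.subset_univ _
  | succ m ih =>
    rintro φ ⟨W, φ', φ'', hW, h', h'', rfl⟩
    exact ⟨W, φ', φ'', hW, h', ih W h'', rfl⟩

theorem radPow_antitone (X Y : QRep Q k) : Antitone fun m => radPow m X Y :=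
  antitone_nat_of_succ_le fun m => radPow_succ_subset m X Y

/-! ### Irreducible morphisms -/

/-- Sums of products of a morphism which is not a split monomorphism and one which is not a split
epimorphism are not irreducible, for bricks `X` and `Y`. -/
theorem not_isIrreducible_of_mem_closure {X Y : QRep Q k} (hX : X.IsBrick) (hY : Y.IsBrick)
    {s : Set (X ⟶ Y)}
    (hs : ∀ φ ∈ s, ∃ (Z : QRep Q k) (f : X ⟶ Z) (g : Z ⟶ Y), Z.FinDim ∧ φ = f ≫ g ∧
      (∀ ρ : Z ⟶ X, f ≫ ρ = 0) ∧ ∀ ρ : Y ⟶ Z, ρ ≫ g = 0)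
    (hX' : X.FinDim) {φ : X ⟶ Y} (hφ : φ ∈ AddSubmonoid.closure s) : ¬ IsIrreducible φ := by
  have key : ∃ (Z : QRep Q k) (f : X ⟶ Z) (g : Z ⟶ Y), Z.FinDim ∧ φ = f ≫ g ∧
      (∀ ρ : Z ⟶ X, f ≫ ρ = 0) ∧ ∀ ρ : Y ⟶ Z, ρ ≫ g = 0 := by
    induction hφ using AddSubmonoid.closure_induction with
    | zero => exact ⟨X, 0, 0, hX', by simp, by simp, by simp⟩
    | mem φ hφ => exact hs φ hφ
    | add φ₁ φ₂ _ _ h₁ h₂ =>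
      obtain ⟨Z₁, f₁, g₁, hZ₁, rfl, hf₁, hg₁⟩ := h₁
      obtain ⟨Z₂, f₂, g₂, hZ₂, rfl, hf₂, hg₂⟩ := h₂
      obtain ⟨f, g, hfg, hf, hg⟩ := exists_comp_eq_add f₁ g₁ f₂ g₂
      refine ⟨_, f, g, hZ₁.sum hZ₂, hfg.symm, fun ρ => ?_, fun ρ => ?_⟩
      · obtain ⟨ρ₁, ρ₂, h⟩ := hf X ρ
        rw [h, hf₁, hf₂, add_zero]
      · obtain ⟨ρ₁, ρ₂, h⟩ := hg Y ρ
        rw [h, hg₁, hg₂, add_zero]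
  obtain ⟨Z, f, g, hZ, hfg, hf, hg⟩ := key
  intro hirr
  rcases hirr.factor Z hZ f g hfg with h | h
  · exact hX.id_ne_zero (by rw [← IsSplitMono.id f, hf])
  · exact hY.id_ne_zero (by rw [← IsSplitEpi.id g, hg])

theorem IsIrreducible.ne_zero {X Y : QRep Q k} (hX : X.IsBrick) (hY : Y.IsBrick) (hX' : X.FinDim) {φ : X ⟶ Y}
    (hφ : IsIrreducible φ) : φ ≠ 0 := fun h0 =>
  not_isIrreducible_of_mem_closure (s := ∅) hX hY (by simp) hX'
    (h0 ▸ AddSubmonoid.zero_mem _) hφ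

theorem IsSumOfIrrComp.comp {X Y Z : QRep Q k} {φ : X ⟶ Y} {ψ : Y ⟶ Z} (hφ : IsIrrComp φ)
    (hψ : IsSumOfIrrComp ψ) : IsSumOfIrrComp (φ ≫ ψ) := by
  unfold IsSumOfIrrComp at hψ ⊢
  induction hψ using AddSubmonoid.closure_induction with
  | zero => rw [Limits.comp_zero]; exact AddSubmonoid.zero_mem _
  | add f g _ _ hf hg => rw [Preadditive.comp_add]; exact AddSubmonoid.add_mem _ hf hg
  | mem f hf => exact AddSubmonoid.subset_closure (.comp _ _ hφ hf)

/-! ### Simple and projective representations -/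

/-- `X` is a simple representation concentrated at the vertex `i`. -/
def IsSimpleAt (X : QRep Q k) (i : V) : Prop :=
  (∀ j, j ≠ i → Subsingleton (X.sp j)) ∧ ∃ x : X.sp i, x ≠ 0 ∧ ∀ y, ∃ c : k, y = c • x

/-- `X` represents the functor `Z ↦ Z_j`. -/
def IsProj (X : QRep Q k) (j : V) : Prop :=
  ∃ x : X.sp j, ∀ (Z : QRep Q k) (z : Z.sp j), ∃! φ : X ⟶ Z, app φ j x = z

theorem IsProj.iso {X Y : QRep Q k} {j : V} (hX : X.IsProj j) (hY : Y.IsProj j) :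
    Nonempty (X ≅ Y) := by
  obtain ⟨x, hx⟩ := hX
  obtain ⟨y, hy⟩ := hY
  obtain ⟨φ, hφ, -⟩ := hx Y y
  obtain ⟨ψ, hψ, -⟩ := hy X x
  refine ⟨⟨φ, ψ, (hx X x).unique ?_ rfl, (hy Y y).unique ?_ rfl⟩⟩
  · simp [hφ, hψ]
  · simp [hφ, hψ]

theorem IsProj.of_iso {X Y : QRep Q k} {j : V} (hX : X.IsProj j) (θ : X ≅ Y) : Y.IsProj j := by
  obtain ⟨x, hx⟩ := hX
  refine ⟨app θ.hom j x, fun Z z => ?_⟩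
  obtain ⟨φ, hφ, hu⟩ := hx Z z
  refine ⟨θ.inv ≫ φ, ?_, fun ψ hψ => ?_⟩
  · change app (θ.hom ≫ θ.inv ≫ φ) j x = z
    simpa using hφ
  · rw [← hu (θ.hom ≫ ψ) hψ]
    simp

/-- The action of a path on a representation. -/
def pathMap (Z : QRep Q k) {i : V} : ∀ {j : V}, Q.Path i j → (Z.sp i →ₗ[k] Z.sp j)
  | _, .nil => LinearMap.id
  | _, .cons α p => Z.map α ∘ₗ Z.pathMap p

theorem app_single {i : V} {Z : QRep Q k} (φ : proj Q k i ⟶ Z) {j : V} (p : Q.Path i j) :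
    app φ j (Finsupp.single p 1 : Q.Path i j →₀ k) =
      Z.pathMap p (app φ i (Finsupp.single .nil 1 : Q.Path i i →₀ k)) := by
  induction p with
  | nil => rfl
  | cons α p ih =>
    have h := app_mapOf φ α rfl rfl (Finsupp.single p 1 : Q.Path i (Q.s α) →₀ k)
    rw [mapOf_rfl, mapOf_rfl, ih] at h
    rw [pathMap, LinearMap.comp_apply, ← h]
    congr 1
    exact (Finsupp.mapDomain_single).symm

theorem isProj_proj_single (Q : FinQuiver V A) (k : Type u) [Field k] (i : V) (Z : QRep Q k)
    (z : Z.sp i) :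
    ∃! φ : proj Q k i ⟶ Z, app φ i (Finsupp.single .nil 1 : Q.Path i i →₀ k) = z := by
  let f (j : V) : (Q.Path i j →₀ k) →ₗ[k] Z.sp j :=
    Finsupp.linearCombination k fun p : Q.Path i j => Z.pathMap p z
  have hf (α : A) : f (Q.t α) ∘ₗ Finsupp.lmapDomain k k (FinQuiver.Path.cons α) =
      Z.map α ∘ₗ f (Q.s α) := by
    refine Finsupp.lhom_ext fun p c => ?_
    simp [f, pathMap]
  refine ⟨homMk (X := proj Q k i) f fun α => LinearMap.congr_fun (hf α), ?_, fun φ hφ => ?_⟩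
  · change f i (Finsupp.single .nil 1) = z
    simp [f, pathMap]
  · have key (j : V) (p : Q.Path i j) :
        app φ j (Finsupp.single p 1 : Q.Path i j →₀ k) = Z.pathMap p z := by
      rw [app_single, hφ]
    have hg (j : V) : ∀ g : (Q.Path i j →₀ k) →ₗ[k] Z.sp j,
        (∀ p, g (Finsupp.single p 1) = Z.pathMap p z) → g = f j := fun g h => by
      refine Finsupp.lhom_ext fun p c => ?_
      rw [← Finsupp.smul_single_one, map_smul, map_smul, h]
      simp [f]
    exact hom_ext fun j => LinearMap.congr_fun (hg j (app φ j) (key j))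

theorem isProj_proj (Q : FinQuiver V A) (k : Type u) [Field k] (i : V) :
    (proj Q k i).IsProj i :=
  ⟨_, isProj_proj_single Q k i⟩

end QRep

namespace FinQuiver

variable {V A : Type} [DecidableEq V] {Q : FinQuiver V A} {i : V}

theorem reflect_s_of_t {α : A} (h : Q.t α = i) : (Q.reflect i).s α = i := by
  simp [reflect, h]

theorem reflect_t_of_t {α : A} (h : Q.t α = i) : (Q.reflect i).t α = Q.s α := by
  simp [reflect, h]

theorem IsSink.reflect_s_of_ne (hi : Q.IsSink i) {α : A} (h : Q.t α ≠ i) :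
    (Q.reflect i).s α = Q.s α := by
  simp [reflect, h, hi α]

theorem IsSink.reflect_t_of_ne (hi : Q.IsSink i) {α : A} (h : Q.t α ≠ i) :
    (Q.reflect i).t α = Q.t α := by
  simp [reflect, h, hi α]

end FinQuiver

open FinQuiver

namespace QRep

variable {V A : Type} [DecidableEq V] [Fintype A] {Q : FinQuiver V A} {i : V}
  {k : Type u} [Field k]

theorem inMap_apply (X : QRep Q k) (y : ∀ α : {α : A // Q.t α = i}, X.sp (Q.s α)) :
    X.inMap i y = ∑ α : {α : A // Q.t α = i}, X.mapOf α.1 rfl α.2 (y α) := by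
  simp [inMap]

theorem inMap_single [DecidableEq A] (X : QRep Q k) (α : {α : A // Q.t α = i})
    (x : X.sp (Q.s α)) :
    X.inMap i (Pi.single α x) = X.mapOf α.1 rfl α.2 x := by
  rw [inMap_apply, Finset.sum_eq_single α]
  · simp
  · intro β _ h
    rw [Pi.single_eq_of_ne h, map_zero]
  · simp

/-! ### Reflections as relations -/

/-- The map `X'_i → ⨁_{t(α) = i} X_{s(α)}` given by the arrows leaving `i` in `σ_i Q` and an
identification of `X` and `X'` off the vertex `i`. -/
def reflOut (hi : Q.IsSink i) (X : QRep Q k) (X' : QRep (Q.reflect i) k)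
    (e : ∀ j, j ≠ i → X.sp j ≃ₗ[k] X'.sp j) :
    X'.sp i →ₗ[k] (∀ α : {α : A // Q.t α = i}, X.sp (Q.s α)) :=
  LinearMap.pi fun α =>
    (e _ (hi α)).symm.toLinearMap ∘ₗ X'.mapOf α.1 (reflect_s_of_t α.2) (reflect_t_of_t α.2)

/-- `X` and `X'` agree off the sink `i`, and `X'_i → ⨁_{t(α) = i} X_{s(α)} → X_i` is exact. -/
structure Refl (hi : Q.IsSink i) (X : QRep Q k) (X' : QRep (Q.reflect i) k) where
  e : ∀ j, j ≠ i → X.sp j ≃ₗ[k] X'.sp j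
  comm : ∀ (α : A) (h : Q.t α ≠ i) (x : X.sp (Q.s α)),
    X'.mapOf α (hi.reflect_s_of_ne h) (hi.reflect_t_of_ne h) (e _ (hi α) x) =
      e _ h (X.map α x)
  exact : ∀ y, X.inMap i y = 0 ↔ ∃ x, reflOut hi X X' e x = y

namespace Refl

variable {hi : Q.IsSink i} {X Y Z : QRep Q k} {X' Y' Z' : QRep (Q.reflect i) k}

def out (R : Refl hi X X') : X'.sp i →ₗ[k] (∀ α : {α : A // Q.t α = i}, X.sp (Q.s α)) :=
  reflOut hi X X' R.e

theorem e_out (R : Refl hi X X') (x : X'.sp i) (α : {α : A // Q.t α = i}) :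
    R.e _ (hi α) (R.out x α) =
      X'.mapOf α.1 (reflect_s_of_t α.2) (reflect_t_of_t α.2) x := by
  simp [out, reflOut]

/-- `X'` is the reflection `S_i^+ X`. -/
def IsPlus (R : Refl hi X X') : Prop := Function.Injective R.out

/-- `X` is the reflection `S_i^- X'`. -/
def IsMinus (_ : Refl hi X X') : Prop := Function.Surjective (X.inMap i)

/-- The morphisms `φ` and `φ'` agree off the vertex `i`. -/
def Match (R : Refl hi X X') (S : Refl hi Y Y') (φ : X ⟶ Y) (φ' : X' ⟶ Y') : Prop :=
  ∀ j h x, S.e j h (app φ j x) = app φ' j (R.e j h x)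

variable {R : Refl hi X X'} {S : Refl hi Y Y'} {T : Refl hi Z Z'}

theorem Match.id : Match R R (𝟙 X) (𝟙 X') := fun _ _ _ => rfl

theorem Match.zero : Match R S 0 0 := fun j h x => by simp

theorem Match.comp {φ : X ⟶ Y} {ψ : Y ⟶ Z} {φ' : X' ⟶ Y'} {ψ' : Y' ⟶ Z'}
    (h : Match R S φ φ') (h' : Match S T ψ ψ') : Match R T (φ ≫ ψ) (φ' ≫ ψ') := fun j hj x => by
  rw [app_comp, h' j hj, h j hj, app_comp]

theorem Match.add {φ ψ : X ⟶ Y} {φ' ψ' : X' ⟶ Y'}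
    (h : Match R S φ φ') (h' : Match R S ψ ψ') : Match R S (φ + ψ) (φ' + ψ') := fun j hj x => by
  rw [app_add, map_add, h' j hj, h j hj, app_add]

theorem Match.smul {φ : X ⟶ Y} {φ' : X' ⟶ Y'} (c : k)
    (h : Match R S φ φ') : Match R S (c • φ) (c • φ') := fun j hj x => by
  rw [app_smul, map_smul, h j hj, app_smul]

theorem _root_.QuivRep.QRep.app_inMap (φ : X ⟶ Y)
    (y : ∀ α : {α : A // Q.t α = i}, X.sp (Q.s α)) :
    app φ i (X.inMap i y) = Y.inMap i fun α => app φ _ (y α) := by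
  rw [inMap_apply, inMap_apply, map_sum]
  exact Finset.sum_congr rfl fun α _ => app_mapOf φ _ _ _ _

theorem Match.out {φ : X ⟶ Y} {φ' : X' ⟶ Y'} (h : Match R S φ φ') (x : X'.sp i)
    (α : {α : A // Q.t α = i}) : app φ _ (R.out x α) = S.out (app φ' i x) α := by
  apply (S.e _ (hi α)).injective
  rw [h, e_out, e_out, app_mapOf]

theorem Match.eq_left (hR : R.IsMinus) {φ ψ : X ⟶ Y} {φ' : X' ⟶ Y'}
    (h : Match R S φ φ') (h' : Match R S ψ φ') : φ = ψ := by
  have off : ∀ j, j ≠ i → ∀ x, app φ j x = app ψ j x := fun j hj x =>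
    (S.e j hj).injective (by rw [h, h'])
  refine hom_ext fun j x => ?_
  by_cases hj : j = i
  · subst hj
    obtain ⟨y, rfl⟩ := hR x
    rw [app_inMap, app_inMap]
    congr 1
    exact funext fun α => off _ (hi α) _
  · exact off j hj x

theorem Match.eq_right (hS : S.IsPlus) {φ : X ⟶ Y} {φ' ψ' : X' ⟶ Y'}
    (h : Match R S φ φ') (h' : Match R S φ ψ') : φ' = ψ' := by
  refine hom_ext fun j x => ?_
  by_cases hj : j = i
  · subst hj
    apply hS
    funext α
    rw [← h.out, ← h'.out]
  · obtain ⟨x, rfl⟩ := (R.e j hj).surjective x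
    rw [← h, ← h']

theorem exists_comp_eq_of_ker_le {E F G : Type*} [AddCommGroup E] [AddCommGroup F]
    [AddCommGroup G] [Module k E] [Module k F] [Module k G] (f : E →ₗ[k] F) (g : E →ₗ[k] G)
    (h : ∀ x, f x = 0 → g x = 0) : ∃ l : F →ₗ[k] G, ∀ x, l (f x) = g x := by
  obtain ⟨p, hp⟩ := f.rangeRestrict.exists_rightInverse_of_surjective f.range_rangeRestrict
  obtain ⟨q, hq⟩ := LinearMap.exists_extend p
  refine ⟨g ∘ₗ q, fun x => ?_⟩
  have h1 : q (f x) = p (f.rangeRestrict x) := LinearMap.congr_fun hq (f.rangeRestrict x)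
  have h2 : f (p (f.rangeRestrict x)) = f x :=
    congrArg Subtype.val (LinearMap.congr_fun hp (f.rangeRestrict x))
  rw [LinearMap.comp_apply, h1, ← sub_eq_zero, ← map_sub]
  apply h
  rw [map_sub, h2, sub_self]

theorem exists_comp_eq_of_range_le {E F G : Type*} [AddCommGroup E] [AddCommGroup F]
    [AddCommGroup G] [Module k E] [Module k F] [Module k G] (f : F →ₗ[k] G) (g : E →ₗ[k] G)
    (h : ∀ x, ∃ y, f y = g x) : ∃ l : E →ₗ[k] F, ∀ x, f (l x) = g x := by
  obtain ⟨p, hp⟩ := f.rangeRestrict.exists_rightInverse_of_surjective f.range_rangeRestrict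
  refine ⟨p ∘ₗ g.codRestrict (LinearMap.range f) h, fun x => ?_⟩
  exact congrArg Subtype.val (LinearMap.congr_fun hp (g.codRestrict (LinearMap.range f) h x))

theorem mapOf_off (R : Refl hi X X') {α : A} {j l : V} (hs : Q.s α = j) (ht : Q.t α = l)
    (hs' : (Q.reflect i).s α = j) (ht' : (Q.reflect i).t α = l) (hj : j ≠ i) (hl : l ≠ i)
    (x : X.sp j) : X'.mapOf α hs' ht' (R.e j hj x) = R.e l hl (X.mapOf α hs ht x) := by
  subst hs ht
  exact R.comm α hl x

theorem exists_match_right (R : Refl hi X X') (S : Refl hi Y Y') (φ : X ⟶ Y) :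
    ∃ φ' : X' ⟶ Y', Match R S φ φ' := by
  obtain ⟨g, hg⟩ := exists_comp_eq_of_range_le S.out
    ((LinearMap.pi fun α => app φ _ ∘ₗ LinearMap.proj α) ∘ₗ R.out) fun x => by
      refine (S.exact _).1 ?_
      have := congrArg (app φ i) ((R.exact (R.out x)).2 ⟨x, rfl⟩)
      rwa [app_inMap, map_zero] at this
  obtain ⟨F, hFi, hF⟩ := exists_family (P := fun j => X'.sp j →ₗ[k] Y'.sp j) g fun j hj =>
    (S.e j hj).toLinearMap ∘ₗ app φ j ∘ₗ (R.e j hj).symm.toLinearMap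
  have hF' : ∀ j hj x, F j (R.e j hj x) = S.e j hj (app φ j x) := fun j hj x => by
    simp [hF j hj]
  have key : ∀ (α : A) (j l : V) (hs : (Q.reflect i).s α = j) (ht : (Q.reflect i).t α = l)
      (x : X'.sp j), F l (X'.mapOf α hs ht x) = Y'.mapOf α hs ht (F j x) := by
    intro α j l hs ht x
    by_cases h : Q.t α = i
    · have hj : i = j := by rw [← hs, reflect_s_of_t h]
      have hl : Q.s α = l := by rw [← ht, reflect_t_of_t h]
      subst hj hl
      have h1 := R.e_out x ⟨α, h⟩
      have h2 := S.e_out (F i x) ⟨α, h⟩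
      rw [← h1, ← h2, hF', hFi, hg]
      rfl
    · have hj : Q.s α = j := by rw [← hs, hi.reflect_s_of_ne h]
      have hl : Q.t α = l := by rw [← ht, hi.reflect_t_of_ne h]
      subst hj hl
      obtain ⟨x, rfl⟩ := (R.e _ (hi α)).surjective x
      rw [hF', R.mapOf_off rfl rfl _ _ _ h, hF', S.mapOf_off rfl rfl _ _ _ h, app_mapOf]
  exact ⟨homMk F fun α x => key α _ _ rfl rfl x, fun j hj x => (hF' j hj x).symm⟩

theorem exists_match_left (R : Refl hi X X') (S : Refl hi Y Y') (φ' : X' ⟶ Y') :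
    ∃ φ : X ⟶ Y, Match R S φ φ' := by
  have hout : ∀ (x : X'.sp i) (α : {α : A // Q.t α = i}),
      (S.e _ (hi α)).symm (app φ' _ (R.e _ (hi α) (R.out x α))) = S.out (app φ' i x) α := by
    intro x α
    rw [R.e_out, app_mapOf, ← S.e_out, LinearEquiv.symm_apply_apply]
  obtain ⟨g, hg⟩ := exists_comp_eq_of_ker_le (X.inMap i) (Y.inMap i ∘ₗ
    (LinearMap.pi fun α => (S.e _ (hi α)).symm.toLinearMap ∘ₗ app φ' _ ∘ₗ
      (R.e _ (hi α)).toLinearMap ∘ₗ LinearMap.proj α)) fun y hy => by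
        obtain ⟨x, hx⟩ := (R.exact y).1 hy
        change R.out x = y at hx
        subst hx
        refine (S.exact _).2 ⟨app φ' i x, ?_⟩
        funext α
        exact (hout x α).symm
  obtain ⟨F, hFi, hF⟩ := exists_family (P := fun j => X.sp j →ₗ[k] Y.sp j) g fun j hj =>
    (S.e j hj).symm.toLinearMap ∘ₗ app φ' j ∘ₗ (R.e j hj).toLinearMap
  have hF' : ∀ j hj x, S.e j hj (F j x) = app φ' j (R.e j hj x) := fun j hj x => by
    simp [hF j hj]
  have key : ∀ (α : A) (l : V) (ht : Q.t α = l)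
      (x : X.sp (Q.s α)), F l (X.mapOf α rfl ht x) = Y.mapOf α rfl ht (F _ x) := by
    classical
    intro α l ht x
    by_cases h : l = i
    · subst h
      have := hg (Pi.single ⟨α, ht⟩ x)
      rw [inMap_single, ← hFi] at this
      refine this.trans ?_
      rw [LinearMap.comp_apply]
      have h2 := inMap_single Y ⟨α, ht⟩ (F (Q.s α) x)
      rw [← h2]
      congr 1
      funext β
      by_cases hβ : β = ⟨α, ht⟩
      · subst hβ
        simp [hF _ (hi α)]
      · simp [Pi.single_eq_of_ne hβ]
    · subst ht
      apply (S.e _ h).injective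
      rw [hF', ← R.mapOf_off rfl rfl (hi.reflect_s_of_ne h) (hi.reflect_t_of_ne h) (hi α) h,
        ← S.mapOf_off rfl rfl (hi.reflect_s_of_ne h) (hi.reflect_t_of_ne h) (hi α) h,
        app_mapOf, hF']
  exact ⟨homMk F fun α x => key α _ rfl x, hF'⟩

/-- Replace `X` by an isomorphic representation. -/
def ofIso (R : Refl hi X X') (θ : X ≅ Y) : Refl hi Y X' where
  e j hj := (isoApp θ j).symm.trans (R.e j hj)
  comm α h x := by
    obtain ⟨x, rfl⟩ := (isoApp θ _).surjective x
    rw [LinearEquiv.trans_apply, LinearEquiv.symm_apply_apply, R.comm α h]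
    refine congrArg (R.e _ h) ?_
    exact (LinearEquiv.eq_symm_apply _).2 (app_mapOf θ.hom α rfl rfl x)
  exact y := by
    have hy : Y.inMap i y = isoApp θ i (X.inMap i fun α => (isoApp θ _).symm (y α)) := by
      rw [isoApp_apply, app_inMap]
      congr 1
      funext α
      exact ((isoApp θ _).apply_symm_apply (y α)).symm
    rw [hy, LinearEquiv.map_eq_zero_iff, R.exact]
    refine exists_congr fun x => ?_
    rw [funext_iff, funext_iff]
    refine forall_congr' fun α => ?_
    exact ((isoApp θ _).eq_symm_apply (x := y α))

theorem IsPlus.ofIso (h : R.IsPlus) (θ : X ≅ Y) : (R.ofIso θ).IsPlus := by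
  intro x y hxy
  apply h
  funext α
  exact (isoApp θ _).injective (congrFun hxy α)

theorem IsMinus.ofIso (h : R.IsMinus) (θ : X ≅ Y) : (R.ofIso θ).IsMinus := by
  intro y
  obtain ⟨x, hx⟩ := h ((isoApp θ i).symm y)
  refine ⟨fun α => isoApp θ _ (x α), ?_⟩
  have := app_inMap θ.hom x
  rw [hx] at this
  exact this.symm.trans ((isoApp θ i).apply_symm_apply y)

end Refl

end QRep

namespace QRep

variable {V A : Type} {Q Q' : FinQuiver V A} {i : V} {k : Type u} [Field k]

/-! ### The reflections `S_i^+` and `S_i^-` -/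

theorem ofEq_mapOf (h : Q = Q') (X : QRep Q k) {α : A} {j l : V} (hs : Q'.s α = j)
    (ht : Q'.t α = l) :
    (X.ofEq h).mapOf α hs ht = X.mapOf α ((congrArg (fun q => q.s α) h).trans hs)
      ((congrArg (fun q => q.t α) h).trans ht) := by
  subst h hs ht
  rfl

variable [DecidableEq V]

section

variable [Fintype A] (X : QRep Q k) (hi : Q.IsSink i)

/-- `X` and `S_i^+ X` agree off `i`. -/
def plusOff {j : V} (hj : j ≠ i) : X.sp j ≃ₗ[k] (X.reflPlus hi).sp j :=
  (X.newSpOff i _ hj).symm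

/-- The space of `S_i^+ X` at `i`. -/
def plusAt {j : V} (hj : j = i) : (X.reflPlus hi).sp j ≃ₗ[k] LinearMap.ker (X.inMap i) :=
  X.newSpAt i (ModuleCat.of k (LinearMap.ker (X.inMap i))) hj

theorem reflPlus_mapOf_off {α : A} (h : Q.t α ≠ i)
    {j l : V} (hs : Q.s α = j) (ht : Q.t α = l) (hs' : (Q.reflect i).s α = j)
    (ht' : (Q.reflect i).t α = l) (hj : j ≠ i) (hl : l ≠ i) (x : X.sp j) :
    (X.reflPlus hi).mapOf α hs' ht' (X.plusOff hi hj x) =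
      X.plusOff hi hl (X.mapOf α hs ht x) := by
  obtain ⟨y, rfl⟩ := (X.plusOff hi hj).symm.surjective x
  rw [LinearEquiv.apply_symm_apply]
  subst hs' ht'
  rw [mapOf_rfl]
  simp only [reflPlus]
  rw [dif_neg h]
  rfl

theorem reflPlus_mapOf_at {α : A} (h : Q.t α = i)
    {j l : V} (hs : Q.s α = l) (hs' : (Q.reflect i).s α = j)
    (ht' : (Q.reflect i).t α = l) (hj : j = i) (hl : l ≠ i) (y : (X.reflPlus hi).sp j) :
    (X.reflPlus hi).mapOf α hs' ht' y =
      X.plusOff hi hl (X.spCast hs ((X.plusAt hi hj y).1 ⟨α, h⟩)) := by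
  subst hs' ht'
  rw [mapOf_rfl]
  simp only [reflPlus]
  rw [dif_pos h]
  rfl

theorem reflPlus_reflOut (x : (X.reflPlus hi).sp i) :
    reflOut hi X (X.reflPlus hi) (fun _ hj => X.plusOff hi hj) x = (X.plusAt hi rfl x).1 := by
  funext α
  simp only [reflOut, LinearMap.pi_apply, LinearMap.comp_apply, LinearEquiv.coe_coe]
  rw [X.reflPlus_mapOf_at hi α.2 rfl _ _ rfl (hi α), LinearEquiv.symm_apply_apply]
  rfl

/-- `X` and `S_i^+ X` are related by a reflection. -/
def reflPlusRefl : Refl hi X (X.reflPlus hi) where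
  e j hj := X.plusOff hi hj
  comm α h x := X.reflPlus_mapOf_off hi h rfl rfl _ _ (hi α) h x
  exact y := by
    constructor
    · intro hy
      refine ⟨(X.plusAt hi rfl).symm ⟨y, hy⟩, ?_⟩
      rw [reflPlus_reflOut, LinearEquiv.apply_symm_apply]
    · rintro ⟨x, rfl⟩
      rw [reflPlus_reflOut]
      exact (X.plusAt hi rfl x).2

theorem isPlus_reflPlusRefl : (X.reflPlusRefl hi).IsPlus := by
  intro x y hxy
  apply (X.plusAt hi rfl).injective
  apply Subtype.ext
  rw [← reflPlus_reflOut, ← reflPlus_reflOut]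
  exact hxy

end

theorem _root_.QuivRep.FinQuiver.IsSink.reflect_s_eq_iff (hi : Q.IsSink i) (α : A) :
    (Q.reflect i).s α = i ↔ Q.t α = i := by
  refine ⟨fun h => ?_, reflect_s_of_t⟩
  by_contra h'
  rw [hi.reflect_s_of_ne h'] at h
  exact hi α h

section

variable [DecidableEq A] (hi : Q.IsSink i) (X' : QRep (Q.reflect i) k)

/-- `S_i^- X'` as a representation of `Q`, for a representation `X'` of `σ_i Q`. -/
def minus : QRep Q k :=
  (X'.reflMinus hi.isSource_reflect).ofEq (Q.reflect_reflect i)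

/-- `S_i^- X'` and `X'` agree off `i`. -/
def minusOff {j : V} (hj : j ≠ i) : (minus hi X').sp j ≃ₗ[k] X'.sp j :=
  X'.newSpOff i _ hj

/-- The space of `S_i^- X'` at `i`. -/
def minusAt {j : V} (hj : j = i) : (minus hi X').sp j ≃ₗ[k]
    (∀ α : {α : A // (Q.reflect i).s α = i}, X'.sp ((Q.reflect i).t α)) ⧸
      LinearMap.range (X'.outMap i) :=
  X'.newSpAt i (ModuleCat.of k ((∀ α : {α : A // (Q.reflect i).s α = i},
    X'.sp ((Q.reflect i).t α)) ⧸ LinearMap.range (X'.outMap i))) hj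

theorem minus_mapOf {α : A} {j l : V} (hs : Q.s α = j) (ht : Q.t α = l)
    (hs' : ((Q.reflect i).reflect i).s α = j) (ht' : ((Q.reflect i).reflect i).t α = l) :
    (minus hi X').mapOf α hs ht = (X'.reflMinus hi.isSource_reflect).mapOf α hs' ht' :=
  ofEq_mapOf (Q.reflect_reflect i) (X'.reflMinus hi.isSource_reflect) hs ht

theorem minus_mapOf_off {α : A} (h : Q.t α ≠ i) {j l : V} (hs : Q.s α = j) (ht : Q.t α = l)
    (hs' : (Q.reflect i).s α = j) (ht' : (Q.reflect i).t α = l) (hj : j ≠ i) (hl : l ≠ i)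
    (x : (minus hi X').sp j) :
    (minus hi X').mapOf α hs ht x =
      (minusOff hi X' hl).symm (X'.mapOf α hs' ht' (minusOff hi X' hj x)) := by
  have hs2 : ((Q.reflect i).reflect i).s α = j := by rw [reflect_reflect, hs]
  have ht2 : ((Q.reflect i).reflect i).t α = l := by rw [reflect_reflect, ht]
  rw [minus_mapOf hi X' hs ht hs2 ht2]
  have h' : (Q.reflect i).s α ≠ i := by rw [hi.reflect_s_of_ne h]; exact hi α
  subst hs2 ht2
  rw [mapOf_rfl]
  simp only [reflMinus]
  rw [dif_neg h']
  rfl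

theorem minus_mapOf_at {α : A} (h : (Q.reflect i).s α = i) {j l : V} (hs : Q.s α = j)
    (ht : Q.t α = l) (hs' : j = (Q.reflect i).t α) (hj : j ≠ i) (hl : l = i)
    (x : (minus hi X').sp j) :
    (minus hi X').mapOf α hs ht x = (minusAt hi X' hl).symm
      ((LinearMap.range (X'.outMap i)).mkQ
        (Pi.single (M := fun β : {α : A // (Q.reflect i).s α = i} => X'.sp ((Q.reflect i).t β))
          ⟨α, h⟩ (X'.spCast hs' (minusOff hi X' hj x)))) := by
  have hs2 : ((Q.reflect i).reflect i).s α = j := by rw [reflect_reflect, hs]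
  have ht2 : ((Q.reflect i).reflect i).t α = l := by rw [reflect_reflect, ht]
  rw [minus_mapOf hi X' hs ht hs2 ht2]
  subst hs2 ht2
  rw [mapOf_rfl]
  simp only [reflMinus]
  rw [dif_pos h]
  rfl

/-- The identification of the two direct sums over the arrows at `i`. -/
def minusSum : (∀ α : {α : A // Q.t α = i}, (minus hi X').sp (Q.s α)) →ₗ[k]
    (∀ β : {α : A // (Q.reflect i).s α = i}, X'.sp ((Q.reflect i).t β)) :=
  LinearMap.pi fun β =>
    (X'.spCast (reflect_t_of_t ((hi.reflect_s_eq_iff _).1 β.2)).symm).toLinearMap ∘ₗ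
    (minusOff hi X' (hi β)).toLinearMap ∘ₗ
    LinearMap.proj (⟨β, (hi.reflect_s_eq_iff _).1 β.2⟩ : {α : A // Q.t α = i})

theorem minusSum_apply (y : ∀ α : {α : A // Q.t α = i}, (minus hi X').sp (Q.s α))
    (β : {α : A // (Q.reflect i).s α = i}) :
    minusSum hi X' y β = X'.spCast (reflect_t_of_t ((hi.reflect_s_eq_iff _).1 β.2)).symm
      (minusOff hi X' (hi β) (y ⟨β, (hi.reflect_s_eq_iff _).1 β.2⟩)) := rfl

theorem minusSum_injective : Function.Injective (minusSum hi X') := by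
  intro y z h
  funext α
  have := congrFun h ⟨α, reflect_s_of_t α.2⟩
  exact (minusOff hi X' (hi α)).injective ((X'.spCast _).injective this)

theorem minusSum_surjective : Function.Surjective (minusSum hi X') := by
  intro y
  refine ⟨fun α => (minusOff hi X' (hi α)).symm
    ((X'.spCast (reflect_t_of_t α.2).symm).symm (y ⟨α, reflect_s_of_t α.2⟩)), ?_⟩
  funext β
  rw [minusSum_apply, LinearEquiv.apply_symm_apply, LinearEquiv.apply_symm_apply]

theorem outMap_eq_minusSum (x : X'.sp i) :
    X'.outMap i x = minusSum hi X' (reflOut hi (minus hi X') X'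
      (fun _ hj => minusOff hi X' hj) x) := by
  funext β
  have key : ∀ (l : V) (hl : (Q.reflect i).t β.1 = l),
      X'.mapOf β.1 β.2 rfl x = X'.spCast hl.symm (X'.mapOf β.1 β.2 hl x) := by
    rintro _ rfl
    rfl
  rw [minusSum_apply]
  simp only [reflOut, outMap, LinearMap.pi_apply, LinearMap.comp_apply, LinearEquiv.coe_coe]
  rw [key _ (reflect_t_of_t ((hi.reflect_s_eq_iff _).1 β.2)), LinearEquiv.apply_symm_apply]

variable [Fintype A]

theorem minus_inMap (y : ∀ α : {α : A // Q.t α = i}, (minus hi X').sp (Q.s α)) :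
    (minus hi X').inMap i y = (minusAt hi X' rfl).symm
        ((LinearMap.range (X'.outMap i)).mkQ (minusSum hi X' y)) := by
  have : (minus hi X').inMap i = (minusAt hi X' rfl).symm.toLinearMap ∘ₗ
        (LinearMap.range (X'.outMap i)).mkQ ∘ₗ minusSum hi X' := by
    refine LinearMap.pi_ext fun α x => ?_
    rw [inMap_single, minus_mapOf_at hi X' (reflect_s_of_t α.2) rfl α.2
      (reflect_t_of_t α.2).symm (hi α) rfl]
    simp only [LinearMap.comp_apply]
    refine congrArg _ (congrArg _ ?_)
    funext β
    rw [minusSum_apply]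
    by_cases hβ : β = ⟨α, reflect_s_of_t α.2⟩
    · subst hβ
      rw [Pi.single_eq_same, Pi.single_eq_same]
    · have : (⟨β, (hi.reflect_s_eq_iff _).1 β.2⟩ : {α : A // Q.t α = i}) ≠ α := fun h =>
        hβ (by subst h; rfl)
      rw [Pi.single_eq_of_ne hβ, Pi.single_eq_of_ne this, map_zero, map_zero]
  exact LinearMap.congr_fun this y

/-- `S_i^- X'` and `X'` are related by a reflection. -/
def minusRefl : Refl hi (minus hi X') X' where
  e j hj := minusOff hi X' hj
  comm α h x := by
    rw [← mapOf_rfl, minus_mapOf_off hi X' h rfl rfl (hi.reflect_s_of_ne h)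
      (hi.reflect_t_of_ne h) (hi α) h, LinearEquiv.apply_symm_apply]
  exact y := by
    rw [minus_inMap, LinearEquiv.map_eq_zero_iff, Submodule.mkQ_apply,
      Submodule.Quotient.mk_eq_zero, LinearMap.mem_range]
    refine exists_congr fun x => ?_
    rw [← (minusSum_injective hi X').eq_iff, outMap_eq_minusSum]

theorem isMinus_minusRefl : (minusRefl hi X').IsMinus := by
  intro x
  obtain ⟨y, hy⟩ := Submodule.mkQ_surjective _ (minusAt hi X' rfl x)
  obtain ⟨z, rfl⟩ := minusSum_surjective hi X' y
  exact ⟨z, by rw [minus_inMap, hy, LinearEquiv.symm_apply_apply]⟩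

end

namespace Refl

variable [Fintype A] {hi : Q.IsSink i} {X : QRep Q k} {X' : QRep (Q.reflect i) k}
  {R : Refl hi X X'}

theorem IsMinus.finDim (hR : R.IsMinus) (hX : X'.FinDim) : X.FinDim := by
  have off : ∀ j, j ≠ i → Module.Finite k (X.sp j) := fun j hj => by
    have := hX j
    exact Module.Finite.equiv (R.e j hj).symm
  intro j
  by_cases hj : j = i
  · subst hj
    have : ∀ α : {α : A // Q.t α = j}, Module.Finite k (X.sp (Q.s α)) := fun α => off _ (hi α)
    exact Module.Finite.of_surjective _ hR
  · exact off j hj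

theorem IsPlus.isZeroRep (hR : R.IsPlus) (hX : X.IsZeroRep) : X'.IsZeroRep := by
  intro j
  by_cases hj : j = i
  · subst hj
    have : ∀ α, Subsingleton (X.sp α) := hX
    exact hR.subsingleton
  · have := hX j
    exact (R.e j hj).symm.injective.subsingleton

theorem IsMinus.isZeroRep (hR : R.IsMinus) (hX : ∀ j, j ≠ i → Subsingleton (X'.sp j)) :
    X.IsZeroRep := by
  have off : ∀ j, j ≠ i → Subsingleton (X.sp j) := fun j hj => by
    have := hX j hj
    exact (R.e j hj).injective.subsingleton
  intro j
  by_cases hj : j = i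
  · subst hj
    have : ∀ α : {α : A // Q.t α = j}, Subsingleton (X.sp (Q.s α)) := fun α => off _ (hi α)
    exact hR.subsingleton
  · exact off j hj

end Refl

end QRep

namespace QRep

variable {V A : Type} {Q : FinQuiver V A} {i : V} {k : Type u} [Field k]

/-! ### Simple representations at a sink -/

theorem IsSimpleAt.of_iso {X Y : QRep Q k} (hX : X.IsSimpleAt i) (θ : X ≅ Y) :
    Y.IsSimpleAt i := by
  obtain ⟨h, x, hx, hs⟩ := hX
  refine ⟨fun j hj => ?_, isoApp θ i x, (LinearEquiv.map_ne_zero_iff _).2 hx, fun y => ?_⟩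
  · have := h j hj
    exact (isoApp θ j).symm.injective.subsingleton
  · obtain ⟨c, hc⟩ := hs ((isoApp θ i).symm y)
    exact ⟨c, by rw [← map_smul, ← hc, LinearEquiv.apply_symm_apply]⟩

theorem IsSimpleAt.finDim {X : QRep Q k} (hX : X.IsSimpleAt i) : X.FinDim := by
  obtain ⟨h, x, hx, hs⟩ := hX
  intro j
  by_cases hj : j = i
  · subst hj
    exact Module.Finite.of_surjective (LinearMap.toSpanSingleton k _ x) fun y => by
      obtain ⟨c, rfl⟩ := hs y
      exact ⟨c, rfl⟩
  · have := h j hj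
    infer_instance

theorem IsSimpleAt.existsUnique_hom {X : QRep Q k} (hi : Q.IsSink i)
    (h : ∀ j, j ≠ i → Subsingleton (X.sp j)) {x : X.sp i} (hx : x ≠ 0)
    (hs : ∀ y, ∃ c : k, y = c • x) (Z : QRep Q k) (z : Z.sp i) :
    ∃! φ : X ⟶ Z, app φ i x = z := by
  obtain ⟨g, hg⟩ := Refl.exists_comp_eq_of_ker_le (LinearMap.toSpanSingleton k _ x)
    (LinearMap.toSpanSingleton k _ z) fun c hc => by
      have : c = 0 := by simpa [hx] using hc
      simp [this]
  have hgx : g x = z := by simpa using hg 1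
  obtain ⟨F, hFi, hF⟩ := exists_family (P := fun j => X.sp j →ₗ[k] Z.sp j) g fun _ _ => 0
  refine ⟨homMk F fun α y => ?_, ?_, fun ψ hψ => ?_⟩
  · have := h _ (hi α)
    rw [Subsingleton.elim y 0]
    simp
  · simpa [hFi] using hgx
  · refine hom_ext fun j y => ?_
    by_cases hj : j = i
    · subst hj
      obtain ⟨c, rfl⟩ := hs y
      change app ψ j x = z at hψ
      rw [map_smul, map_smul, hψ, app_homMk, hFi, hgx]
    · have := h j hj
      rw [Subsingleton.elim y 0, map_zero, map_zero]

theorem IsSimpleAt.isBrick {X : QRep Q k} (hX : X.IsSimpleAt i) (hi : Q.IsSink i) :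
    X.IsBrick := by
  obtain ⟨h, x, hx, hs⟩ := hX
  refine ⟨fun h0 => hx ((h0 i).elim _ _), fun φ => ?_⟩
  obtain ⟨c, hc⟩ := hs (app φ i x)
  exact ⟨c, (IsSimpleAt.existsUnique_hom hi h hx hs X (c • x)).unique hc (by simp)⟩

theorem IsSimpleAt.isProj {X : QRep Q k} (hX : X.IsSimpleAt i) (hi : Q.IsSink i) :
    X.IsProj i := by
  obtain ⟨h, x, hx, hs⟩ := hX
  exact ⟨x, IsSimpleAt.existsUnique_hom hi h hx hs⟩

theorem _root_.QuivRep.FinQuiver.IsSink.path_eq (hi : Q.IsSink i) {j : V} (p : Q.Path i j) :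
    ∃ h : i = j, p = h ▸ Path.nil := by
  induction p with
  | nil => exact ⟨rfl, rfl⟩
  | cons α p ih =>
    obtain ⟨h, -⟩ := ih
    exact absurd h.symm (hi α)

theorem isSimpleAt_proj (hi : Q.IsSink i) : (proj Q k i).IsSimpleAt i := by
  refine ⟨fun j hj => ?_, (Finsupp.single .nil 1 : Q.Path i i →₀ k), fun h => ?_, fun y => ?_⟩
  · have : IsEmpty (Q.Path i j) := ⟨fun p => hj (hi.path_eq p).1.symm⟩
    exact inferInstanceAs (Subsingleton (Q.Path i j →₀ k))
  · exact one_ne_zero ((Finsupp.single_eq_zero (a := (Path.nil : Q.Path i i)) (b := (1 : k))).1 h)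
  · have key : ∀ y : Q.Path i i →₀ k, ∃ c : k, y = c • Finsupp.single .nil 1 := fun y => by
      refine ⟨y .nil, ?_⟩
      ext p
      obtain ⟨_, rfl⟩ := hi.path_eq p
      simp
    exact key y

section

variable [DecidableEq V] [Fintype A]

theorem IsSimpleAt.isSplitMono_or {X Z : QRep Q k} (hX : X.IsSimpleAt i) (hi : Q.IsSink i)
    (φ : X ⟶ Z) : IsSplitMono φ ∨ ∀ x, app φ i x ∈ LinearMap.range (Z.inMap i) := by
  classical
  obtain ⟨h, x, hx, hs⟩ := hX
  by_cases hz : app φ i x ∈ LinearMap.range (Z.inMap i)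
  · refine Or.inr fun y => ?_
    obtain ⟨c, rfl⟩ := hs y
    rw [map_smul]
    exact Submodule.smul_mem _ _ hz
  · left
    obtain ⟨f, hf, hle⟩ := Submodule.exists_le_ker_of_notMem hz
    obtain ⟨F, hFi, hF⟩ := exists_family (P := fun j => Z.sp j →ₗ[k] X.sp j)
      (f.smulRight ((f (app φ i x))⁻¹ • x)) fun _ _ => 0
    have key : ∀ (α : A) (l : V) (ht : Q.t α = l) (y : Z.sp (Q.s α)),
        F l (Z.mapOf α rfl ht y) = X.mapOf α rfl ht (F _ y) := by
      intro α l ht y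
      by_cases hl : l = i
      · subst hl
        have h0 : f (Z.mapOf α rfl ht y) = 0 := hle ⟨_, inMap_single Z ⟨α, ht⟩ y⟩
        have := h _ (hi α)
        rw [Subsingleton.elim (F _ y) 0, hFi, LinearMap.smulRight_apply, h0, zero_smul, map_zero]
      · have := h l hl
        exact Subsingleton.elim _ _
    refine ⟨⟨⟨homMk F fun α y => key α _ rfl y, ?_⟩⟩⟩
    refine (IsSimpleAt.existsUnique_hom hi h hx hs X x).unique ?_ rfl
    have hFx : F i (app φ i x) = x := by
      rw [hFi, LinearMap.smulRight_apply, smul_smul, mul_inv_cancel₀ hf, one_smul]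
    exact hFx

theorem IsSimpleAt.hom_eq_zero {X Y : QRep Q k} (hY : Y.IsSimpleAt i) (hi : Q.IsSink i)
    (hX : Function.Surjective (X.inMap i)) (φ : X ⟶ Y) : φ = 0 := by
  refine hom_ext fun j x => ?_
  by_cases hj : j = i
  · subst hj
    obtain ⟨y, rfl⟩ := hX x
    rw [app_inMap, app_zero, inMap_apply]
    refine Finset.sum_eq_zero fun α _ => ?_
    have := hY.1 _ (hi α)
    rw [Subsingleton.elim (app φ _ (y α)) 0, map_zero]
  · have := hY.1 j hj
    exact Subsingleton.elim _ _

end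

/-! ### Projective representations of a graded quiver -/

theorem IsProj.mem_span {Y : QRep Q k} {j : V} {y : Y.sp j}
    (hy : ∀ (Z : QRep Q k) (z : Z.sp j), ∃! φ : Y ⟶ Z, app φ j y = z) (l : V) (x : Y.sp l) :
    x ∈ Submodule.span k (Set.range fun p : Q.Path j l => Y.pathMap p y) := by
  obtain ⟨ψ, hψ, -⟩ := isProj_proj_single Q k j Y y
  obtain ⟨φ, hφ, -⟩ := hy (proj Q k j) (Finsupp.single .nil 1 : Q.Path j j →₀ k)
  have h : φ ≫ ψ = 𝟙 Y := (hy Y y).unique (by simp [hφ, hψ]) rfl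
  have key : ∀ (g : (Q.Path j l →₀ k) →ₗ[k] Y.sp l) (w : Q.Path j l →₀ k),
      (∀ p, g (Finsupp.single p 1) = Y.pathMap p y) →
        g w ∈ Submodule.span k (Set.range fun p : Q.Path j l => Y.pathMap p y) := by
    intro g w hg
    induction w using Finsupp.induction_linear with
    | zero => simp
    | add f f' hf hf' => rw [map_add]; exact Submodule.add_mem _ hf hf'
    | single p c =>
      rw [← Finsupp.smul_single_one, map_smul, hg]
      exact Submodule.smul_mem _ _ (Submodule.subset_span ⟨p, rfl⟩)
  have hx : x = app ψ l (app φ l x) := congrArg (fun ρ => app ρ l x) h.symm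
  rw [hx]
  exact key (app ψ l) _ fun p => (app_single ψ p).trans (by rw [hψ])

section Graded

variable {h : V → ℤ}

theorem path_height (hh : ∀ α, h (Q.s α) = h (Q.t α) + 1) {j l : V} (p : Q.Path j l) : h l ≤ h j := by
  induction p with
  | nil => rfl
  | cons α p ih => have := hh α; omega

theorem pathMap_of_height_eq (hh : ∀ α, h (Q.s α) = h (Q.t α) + 1)
    {j l : V} (p : Q.Path j l) (hl : h l = h j) :
    ∃ e : j = l, ∀ (Y : QRep Q k) (y : Y.sp j), Y.pathMap p y = Y.spCast e y := by
  cases p with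
  | nil => exact ⟨rfl, fun _ _ => rfl⟩
  | cons α p =>
    have := path_height hh p
    have := hh α
    omega

theorem pathMap_of_height_eq_succ (hh : ∀ α, h (Q.s α) = h (Q.t α) + 1)
    {j l : V} (p : Q.Path j l) (hl : h j = h l + 1) :
    ∃ (α : A) (hs : Q.s α = j) (ht : Q.t α = l), ∀ (Y : QRep Q k) (y : Y.sp j),
      Y.pathMap p y = Y.mapOf α hs ht y := by
  cases p with
  | nil => omega
  | cons α p =>
    obtain ⟨e, he⟩ := pathMap_of_height_eq (k := k) hh p (by have := hh α; omega)
    exact ⟨α, e.symm, rfl, fun Y y => by rw [pathMap, LinearMap.comp_apply, he]; rfl⟩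

/-- For an arrow `j → i` to a sink of a graded quiver, the morphisms from the simple representation
at `i` to `P(j)`. -/
theorem IsSimpleAt.hom_isProj [DecidableEq V] [Fintype A]
    (hh : ∀ α, h (Q.s α) = h (Q.t α) + 1)
    (hsimple : ∀ α β, Q.s α = Q.s β → Q.t α = Q.t β → α = β)
    {X Y : QRep Q k} (hX : X.IsSimpleAt i) (hi : Q.IsSink i)
    {α : A} (hα : Q.t α = i) (hY : Y.IsProj (Q.s α)) :
    ∃ f : X ⟶ Y, f ≠ 0 ∧ (∀ φ : X ⟶ Y, ∃ c : k, φ = c • f) ∧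
      ∀ φ : X ⟶ Y, φ ≠ 0 → ∀ (Z : QRep Q k) (φ' : X ⟶ Z) (φ'' : Z ⟶ Y), φ = φ' ≫ φ'' →
        IsSplitMono φ' ∨ IsSplitEpi φ'' := by
  have hX' := hX
  obtain ⟨hX0, x, hx, hs⟩ := hX
  obtain ⟨y, hy⟩ := hY
  have huniv := IsSimpleAt.existsUnique_hom hi hX0 hx hs
  -- the relevant spaces of `Y`
  have hYs : ∀ w : Y.sp (Q.s α), ∃ c : k, w = c • y := fun w => by
    have hw := IsProj.mem_span hy _ w
    have : (Set.range fun p : Q.Path (Q.s α) (Q.s α) => Y.pathMap p y) ⊆ {y} := by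
      rintro _ ⟨p, rfl⟩
      obtain ⟨e, he⟩ := pathMap_of_height_eq (k := k) hh p rfl
      exact he Y y
    obtain ⟨c, hc⟩ := Submodule.mem_span_singleton.1 (Submodule.span_mono this hw)
    exact ⟨c, hc.symm⟩
  have hYi : ∀ w : Y.sp i, ∃ c : k, w = c • Y.mapOf α rfl hα y := fun w => by
    have hw := IsProj.mem_span hy _ w
    have : (Set.range fun p : Q.Path (Q.s α) i => Y.pathMap p y) ⊆ {Y.mapOf α rfl hα y} := by
      rintro _ ⟨p, rfl⟩
      obtain ⟨β, hs, ht, hβ⟩ := pathMap_of_height_eq_succ (k := k) hh p (by rw [hh, hα])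
      obtain rfl : β = α := hsimple _ _ hs (ht.trans hα.symm)
      exact hβ Y y
    obtain ⟨c, hc⟩ := Submodule.mem_span_singleton.1 (Submodule.span_mono this hw)
    exact ⟨c, hc.symm⟩
  have hYβ : ∀ β, Q.t β = i → β ≠ α → ∀ w : Y.sp (Q.s β), w = 0 := fun β hβ hne w => by
    have hw := IsProj.mem_span hy _ w
    have : IsEmpty (Q.Path (Q.s α) (Q.s β)) := ⟨fun p => by
      obtain ⟨e, -⟩ := pathMap_of_height_eq (k := k) hh p (by rw [hh, hh, hβ, hα])
      exact hne (hsimple _ _ e.symm (hβ.trans hα.symm))⟩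
    rw [Set.range_eq_empty, Submodule.span_empty] at hw
    exact hw
  have hne : Y.mapOf α rfl hα y ≠ 0 := by
    intro h0
    obtain ⟨φ, hφ, -⟩ := hy (proj Q k (Q.s α)) (Finsupp.single .nil 1 : Q.Path _ _ →₀ k)
    subst hα
    have h1 := app_mapOf φ α rfl rfl y
    rw [h0, map_zero, hφ] at h1
    have h2 : Finsupp.mapDomain (Path.cons α) (Finsupp.single .nil 1 : Q.Path _ _ →₀ k) = 0 :=
      h1.symm
    rw [Finsupp.mapDomain_single, Finsupp.single_eq_zero] at h2
    exact one_ne_zero h2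
  obtain ⟨f, hf, -⟩ := huniv Y (Y.mapOf α rfl hα y)
  refine ⟨f, fun h0 => hne (by rw [← hf, h0, app_zero]), fun φ => ?_, ?_⟩
  · obtain ⟨c, hc⟩ := hYi (app φ i x)
    exact ⟨c, (huniv Y _).unique hc (by rw [app_smul, hf])⟩
  · rintro φ hφ Z φ' φ'' rfl
    refine (hX'.isSplitMono_or hi φ').imp_right fun hr => ?_
    obtain ⟨w, hw⟩ := hr x
    have h1 : app (φ' ≫ φ'') i x = Y.mapOf α rfl hα (app φ'' _ (w ⟨α, hα⟩)) := by
      rw [app_comp, ← hw, app_inMap, inMap_apply]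
      rw [Finset.sum_eq_single ⟨α, hα⟩]
      · intro β _ hβ
        rw [hYβ β β.2 (fun h => hβ (Subtype.ext h)) (app φ'' _ (w β)), map_zero]
      · simp
    obtain ⟨c, hc⟩ := hYs (app φ'' _ (w ⟨α, hα⟩))
    have hc0 : c ≠ 0 := by
      rintro rfl
      apply hφ
      refine (huniv Y 0).unique ?_ rfl
      rw [h1, hc, zero_smul, map_zero]
    obtain ⟨σ, hσ, -⟩ := hy Z (c⁻¹ • w ⟨α, hα⟩)
    refine ⟨⟨⟨σ, (hy Y y).unique ?_ rfl⟩⟩⟩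
    rw [app_comp, hσ, map_smul, hc, smul_smul, inv_mul_cancel₀ hc0, one_smul]

end Graded

end QRep

namespace FinQuiver

variable {V A : Type} {Q : FinQuiver V A}

/-- Some arrow joins `i` and `j`. -/
def Adj (Q : FinQuiver V A) (i j : V) : Prop :=
  ∃ α, (Q.s α = i ∧ Q.t α = j) ∨ (Q.s α = j ∧ Q.t α = i)

variable [DecidableEq V]

theorem adj_reflect {i j l : V} : (Q.reflect i).Adj j l ↔ Q.Adj j l := by
  refine exists_congr fun α => ?_
  simp only [reflect]
  split_ifs <;> tauto

/-- The quiver obtained by reflecting at `v 0, …, v (t - 1)`. -/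
def seqQuiver : ℕ → FinQuiver V A → (ℕ → V) → FinQuiver V A
  | 0, Q, _ => Q
  | t + 1, Q, v => seqQuiver t (Q.reflect (v 0)) fun s => v (s + 1)

/-- A graded quiver without multiple arrows, with an infinite sequence of vertices which are
successively sinks and in which every vertex occurs infinitely often. -/
structure SinkOrder (Q : FinQuiver V A) (h : V → ℤ) (v : ℕ → V) : Prop where
  height : ∀ α, h (Q.s α) = h (Q.t α) + 1
  simple : ∀ α β, Q.s α = Q.s β → Q.t α = Q.t β → α = β
  sink : ∀ t, (seqQuiver t Q v).IsSink (v t)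
  often : ∀ j N, ∃ t, N ≤ t ∧ v t = j

theorem SinkOrder.next {h : V → ℤ} {v : ℕ → V} (H : SinkOrder Q h v) :
    SinkOrder (Q.reflect (v 0)) (Function.update h (v 0) (h (v 0) + 2)) fun t => v (t + 1) := by
  have hi : Q.IsSink (v 0) := H.sink 0
  refine ⟨fun α => ?_, fun α β hs ht => ?_, fun t => H.sink (t + 1), fun j N => ?_⟩
  · have := H.height α
    by_cases hα : Q.t α = v 0
    · rw [reflect_s_of_t hα, reflect_t_of_t hα, Function.update_self,
        Function.update_of_ne (hi α), this, hα]
      ring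
    · rw [hi.reflect_s_of_ne hα, hi.reflect_t_of_ne hα, Function.update_of_ne hα,
        Function.update_of_ne (hi α), this]
  · have hiff : Q.t α = v 0 ↔ Q.t β = v 0 := by
      rw [← hi.reflect_s_eq_iff, ← hi.reflect_s_eq_iff, hs]
    by_cases hα : Q.t α = v 0
    · have hβ := hiff.1 hα
      rw [reflect_t_of_t hα, reflect_t_of_t hβ] at ht
      exact H.simple α β ht (hα.trans hβ.symm)
    · have hβ := fun h => hα (hiff.2 h)
      rw [hi.reflect_t_of_ne hα, hi.reflect_t_of_ne hβ] at ht
      rw [hi.reflect_s_of_ne hα, hi.reflect_s_of_ne hβ] at hs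
      exact H.simple α β hs ht
  · obtain ⟨t, ht, rfl⟩ := H.often j (N + 1)
    exact ⟨t - 1, by omega, by rw [Nat.sub_add_cancel (by omega)]⟩

/-- `b` is the first occurrence after `a` of a neighbour of the vertex `v a`. -/
def Follows (Q : FinQuiver V A) (v : ℕ → V) (a b : ℕ) : Prop :=
  a < b ∧ (∀ c, a < c → c < b → v c ≠ v b) ∧ Q.Adj (v a) (v b)

theorem follows_succ {v : ℕ → V} {a b : ℕ} :
    Q.Follows v (a + 1) (b + 1) ↔ (Q.reflect (v 0)).Follows (fun t => v (t + 1)) a b := by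
  rw [Follows, Follows, adj_reflect, Nat.add_lt_add_iff_right]
  refine and_congr_right fun _ => and_congr_left fun _ => ⟨fun h c hc hc' => ?_, fun h c hc hc' => ?_⟩
  · exact h (c + 1) (by omega) (by omega)
  · have := h (c - 1) (by omega) (by omega)
    rwa [Nat.sub_add_cancel (by omega)] at this

/-- The degree of the `a`-th term of a sequence of sinks. -/
def level : ℕ → (V → ℤ) → (ℕ → V) → ℤ
  | 0, h, v => h (v 0)
  | a + 1, h, v => level a (Function.update h (v 0) (h (v 0) + 2)) fun t => v (t + 1)

theorem level_of_first {v : ℕ → V} {b : ℕ} (h : V → ℤ) (hb : ∀ c < b, v c ≠ v b) :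
    level b h v = h (v b) := by
  induction b generalizing h v with
  | zero => rfl
  | succ b ih =>
    rw [level, ih _ fun c hc => hb (c + 1) (by omega),
      Function.update_of_ne (hb 0 (by omega)).symm]

theorem SinkOrder.level_follows {h : V → ℤ} {v : ℕ → V} (H : SinkOrder Q h v) {a b : ℕ}
    (hab : Q.Follows v a b) : level b h v = level a h v + 1 := by
  induction a generalizing Q h v b with
  | zero =>
    obtain ⟨h0, h1, α, hα⟩ := hab
    have hi : Q.IsSink (v 0) := H.sink 0
    have hα : Q.s α = v b ∧ Q.t α = v 0 := hα.resolve_left fun h => hi α h.1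
    rw [level_of_first h fun c hc => ?_, ← hα.1, H.height, hα.2]
    · rfl
    · rcases Nat.eq_zero_or_pos c with rfl | hc'
      · rw [← hα.1]
        exact (hi α).symm
      · exact h1 c hc' hc
  | succ a ih =>
    obtain ⟨b, rfl⟩ : ∃ b', b = b' + 1 := ⟨b - 1, by have := hab.1; omega⟩
    exact ih H.next (follows_succ.1 hab)

end FinQuiver

open FinQuiver

namespace QRep

variable {V A : Type} [DecidableEq V] [Fintype A] {k : Type u} [Field k]

/-- `X ≅ S⁻_{v 0} ⋯ S⁻_{v (a - 1)} S(v a)`, where no reflection is degenerate. -/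
def IsPre : ℕ → (Q : FinQuiver V A) → (ℕ → V) → QRep Q k → Prop
  | 0, Q, v, X => Q.IsSink (v 0) ∧ X.IsSimpleAt (v 0)
  | a + 1, Q, v, X => ∃ (hi : Q.IsSink (v 0)) (X' : QRep (Q.reflect (v 0)) k) (R : Refl hi X X'),
      R.IsPlus ∧ R.IsMinus ∧ IsPre a (Q.reflect (v 0)) (fun t => v (t + 1)) X'

variable {Q : FinQuiver V A} {v : ℕ → V} {h : V → ℤ} {a b : ℕ}

theorem IsPre.of_iso {X Y : QRep Q k} (hX : IsPre a Q v X) (θ : X ≅ Y) : IsPre a Q v Y := by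
  cases a with
  | zero => exact ⟨hX.1, hX.2.of_iso θ⟩
  | succ a =>
    obtain ⟨hi, X', R, hp, hm, hX'⟩ := hX
    exact ⟨hi, X', R.ofIso θ, hp.ofIso θ, hm.ofIso θ, hX'⟩

theorem IsPre.finDim {X : QRep Q k} (hX : IsPre a Q v X) : X.FinDim := by
  induction a generalizing Q v with
  | zero => exact hX.2.finDim
  | succ a ih =>
    obtain ⟨hi, X', R, hp, hm, hX'⟩ := hX
    exact hm.finDim (ih hX')

theorem IsPre.isBrick {X : QRep Q k} (hX : IsPre a Q v X) : X.IsBrick := by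
  induction a generalizing Q v with
  | zero => exact hX.2.isBrick hX.1
  | succ a ih =>
    obtain ⟨hi, X', R, hp, hm, hX'⟩ := hX
    refine ⟨fun h0 => (ih hX').nonzero (hp.isZeroRep h0), fun φ => ?_⟩
    obtain ⟨φ', hφ'⟩ := R.exists_match_right R φ
    obtain ⟨c, rfl⟩ := (ih hX').scalar φ'
    exact ⟨c, hφ'.eq_left hm (Refl.Match.id.smul c)⟩

theorem IsPre.isIndec {X : QRep Q k} (hX : IsPre a Q v X) : X.IsIndec :=
  hX.isBrick.isIndec hX.finDim

theorem IsPre.hom_eq_zero {X Y : QRep Q k} (hX : IsPre a Q v X) (hY : IsPre b Q v Y)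
    (hab : b < a) (φ : X ⟶ Y) : φ = 0 := by
  induction b generalizing Q v a with
  | zero =>
    obtain ⟨a, rfl⟩ : ∃ a', a = a' + 1 := ⟨a - 1, by omega⟩
    obtain ⟨hi, X', R, hp, hm, hX'⟩ := hX
    exact hY.2.hom_eq_zero hY.1 hm φ
  | succ b ih =>
    obtain ⟨a, rfl⟩ : ∃ a', a = a' + 1 := ⟨a - 1, by omega⟩
    obtain ⟨hi, X', R, hp, hm, hX'⟩ := hX
    obtain ⟨_, Y', S, hp', hm', hY'⟩ := hY
    obtain ⟨φ', hφ'⟩ := R.exists_match_right S φ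
    obtain rfl := ih hX' hY' (by omega) φ'
    exact hφ'.eq_left hm Refl.Match.zero

theorem IsPre.nonempty_iso {X Y : QRep Q k} (hX : IsPre a Q v X) (hY : IsPre a Q v Y) :
    Nonempty (X ≅ Y) := by
  induction a generalizing Q v with
  | zero => exact (hX.2.isProj hX.1).iso (hY.2.isProj hY.1)
  | succ a ih =>
    obtain ⟨hi, X', R, hp, hm, hX'⟩ := hX
    obtain ⟨_, Y', S, hp', hm', hY'⟩ := hY
    obtain ⟨θ⟩ := ih hX' hY'
    obtain ⟨φ, hφ⟩ := R.exists_match_left S θ.hom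
    obtain ⟨ψ, hψ⟩ := S.exists_match_left R θ.inv
    refine ⟨⟨φ, ψ, ?_, ?_⟩⟩
    · have := hφ.comp hψ
      rw [θ.hom_inv_id] at this
      exact this.eq_left hm Refl.Match.id
    · have := hψ.comp hφ
      rw [θ.inv_hom_id] at this
      exact this.eq_left hm' Refl.Match.id

theorem IsPre.isIso_or_eq_zero {X Y : QRep Q k} (hX : IsPre a Q v X) (hY : IsPre a Q v Y)
    (φ : X ⟶ Y) : IsIso φ ∨ φ = 0 := by
  obtain ⟨θ⟩ := hX.nonempty_iso hY
  obtain ⟨c, hc⟩ := hX.isBrick.scalar (φ ≫ θ.inv)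
  have hφ : φ = c • θ.hom := by
    rw [← Category.comp_id φ, ← θ.inv_hom_id, ← Category.assoc, hc]
    simp
  by_cases h0 : c = 0
  · exact Or.inr (by rw [hφ, h0, zero_smul])
  · refine Or.inl ⟨⟨c⁻¹ • θ.inv, ?_, ?_⟩⟩
    · simp [hφ, smul_smul, h0]
    · simp [hφ, smul_smul, h0]

theorem IsPre.not_isSplitMono {X Y : QRep Q k} (hX : IsPre a Q v X) (hY : IsPre b Q v Y)
    (hab : a < b) (φ : X ⟶ Y) : ¬ IsSplitMono φ := fun hs => by
  apply hX.isBrick.id_ne_zero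
  rw [← IsSplitMono.id φ, hY.hom_eq_zero hX hab (retraction φ), Limits.comp_zero]

theorem IsPre.not_isSplitEpi {X Y : QRep Q k} (hX : IsPre a Q v X) (hY : IsPre b Q v Y)
    (hab : a < b) (φ : X ⟶ Y) : ¬ IsSplitEpi φ := fun hs => by
  apply hY.isBrick.id_ne_zero
  rw [← IsSplitEpi.id φ, hY.hom_eq_zero hX hab (section_ φ), Limits.zero_comp]

/-! ### Degenerate reflections -/

namespace Refl

variable {i : V} {hi : Q.IsSink i} {X : QRep Q k} {X' : QRep (Q.reflect i) k}

theorem isPlus_or (R : Refl hi X X') (hX : X'.IsBrick) :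
    R.IsPlus ∨ ∀ j, j ≠ i → Subsingleton (X'.sp j) := by
  by_cases hR : R.IsPlus
  · exact Or.inl hR
  · right
    obtain ⟨x, hx, hx0⟩ : ∃ x, R.out x = 0 ∧ x ≠ 0 := by
      by_contra! hc
      exact hR ((injective_iff_map_eq_zero _).2 hc)
    obtain ⟨f, hf, -⟩ := Submodule.exists_le_ker_of_notMem (p := (⊥ : Submodule k (X'.sp i)))
      (v := x) (by simpa using hx0)
    obtain ⟨F, hFi, hF⟩ := exists_family (P := fun j => X'.sp j →ₗ[k] X'.sp j)
      (f.smulRight x) fun _ _ => 0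
    have hsrc := hi.isSource_reflect
    have hxα : ∀ (α : A) (l : V) (hs : (Q.reflect i).s α = i) (ht : (Q.reflect i).t α = l),
        X'.mapOf α hs ht x = 0 := by
      intro α l hs ht
      have hα := (hi.reflect_s_eq_iff α).1 hs
      obtain rfl : Q.s α = l := by rw [← ht, reflect_t_of_t hα]
      have := R.e_out x ⟨α, hα⟩
      rw [hx] at this
      rw [← this]
      exact map_zero _
    have key : ∀ (α : A) (j l : V) (hs : (Q.reflect i).s α = j) (ht : (Q.reflect i).t α = l)
        (y : X'.sp j), F l (X'.mapOf α hs ht y) = X'.mapOf α hs ht (F j y) := by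
      intro α j l hs ht y
      have hl : l ≠ i := by rw [← ht]; exact hsrc α
      rw [hF l hl, LinearMap.zero_apply]
      by_cases hj : j = i
      · subst hj
        rw [hFi, LinearMap.smulRight_apply, map_smul, hxα, smul_zero]
      · rw [hF j hj, LinearMap.zero_apply, map_zero]
    obtain ⟨c, hc⟩ := hX.scalar (homMk F fun α y => key α _ _ rfl rfl y)
    have hc0 : c ≠ 0 := by
      rintro rfl
      have h1 : F i x = (0 : k) • x := congrArg (fun φ => app φ i x) hc
      rw [hFi, LinearMap.smulRight_apply, zero_smul] at h1
      exact (smul_ne_zero hf hx0) h1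
    intro j hj
    refine subsingleton_of_forall_eq 0 fun y => ?_
    have h1 : F j y = c • y := congrArg (fun φ => app φ j y) hc
    rw [hF j hj, LinearMap.zero_apply] at h1
    exact (smul_eq_zero.1 h1.symm).resolve_left hc0

theorem IsPlus.hom_eq_zero {R : Refl hi X X'} (hR : R.IsPlus) {E : QRep (Q.reflect i) k}
    (hE : ∀ j, j ≠ i → Subsingleton (E.sp j)) (φ : E ⟶ X') : φ = 0 := by
  refine hom_ext fun j x => ?_
  by_cases hj : j = i
  · subst hj
    apply hR
    funext α
    apply (R.e _ (hi α)).injective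
    have := hE _ (hi α)
    rw [R.e_out, ← app_mapOf, Subsingleton.elim (E.mapOf _ _ _ x) 0, app_zero, map_zero]
    simp
  · have := hE j hj
    rw [Subsingleton.elim x 0, map_zero, map_zero]

theorem IsMinus.isProj {R : Refl hi X X'} (hR : R.IsMinus) {j : V} (hj : j ≠ i)
    (hX : X'.IsProj j) : X.IsProj j := by
  obtain ⟨x, hx⟩ := hX
  refine ⟨(R.e j hj).symm x, fun Z z => ?_⟩
  obtain ⟨φ', hφ', hu⟩ := hx (Z.reflPlus hi) ((Z.reflPlusRefl hi).e j hj z)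
  obtain ⟨φ, hφ⟩ := R.exists_match_left (Z.reflPlusRefl hi) φ'
  refine ⟨φ, ?_, fun ψ hψ => ?_⟩
  · apply ((Z.reflPlusRefl hi).e j hj).injective
    rw [hφ, LinearEquiv.apply_symm_apply, hφ']
  · obtain ⟨ψ', hψ'⟩ := R.exists_match_right (Z.reflPlusRefl hi) ψ
    have : ψ' = φ' := hu ψ' (by
      change app ψ' j x = _
      rw [← hψ, hψ', LinearEquiv.apply_symm_apply])
    subst this
    exact hψ'.eq_left hR hφ

end Refl

theorem IsPre.isProj {Y : QRep Q k} (hY : IsPre b Q v Y) (hb : ∀ c < b, v c ≠ v b) :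
    Y.IsProj (v b) := by
  induction b generalizing Q v with
  | zero => exact hY.2.isProj hY.1
  | succ b ih =>
    obtain ⟨hi, Y', S, hp, hm, hY'⟩ := hY
    exact hm.isProj (hb 0 (by omega)).symm (ih hY' fun c hc => hb (c + 1) (by omega))

theorem isPlus_minusRefl_proj [DecidableEq A] {i j : V} (hi : Q.IsSink i) (hj : j ≠ i) :
    (minusRefl hi (proj (Q.reflect i) k j)).IsPlus := by
  have hp : ∀ l, (Q.reflect i).Path j l → l ≠ i := by
    rintro _ (_ | ⟨α, p⟩)
    · exact hj
    · exact hi.isSource_reflect α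
  have : IsEmpty ((Q.reflect i).Path j i) := ⟨fun p => hp i p rfl⟩
  have : Subsingleton ((proj (Q.reflect i) k j).sp i) :=
    inferInstanceAs (Subsingleton ((Q.reflect i).Path j i →₀ k))
  exact Function.injective_of_subsingleton _

theorem isPre_proj [DecidableEq A] (H : SinkOrder Q h v) (hb : ∀ c < b, v c ≠ v b) :
    IsPre b Q v (proj Q k (v b)) := by
  induction b generalizing Q v h with
  | zero => exact ⟨H.sink 0, isSimpleAt_proj (H.sink 0)⟩
  | succ b ih =>
    have hi : Q.IsSink (v 0) := H.sink 0
    have hE := ih H.next fun c hc => hb (c + 1) (by omega)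
    have hp := isPlus_minusRefl_proj (k := k) hi (hb 0 (by omega)).symm
    have hpre : IsPre (b + 1) Q v (minus hi (proj (Q.reflect (v 0)) k (v (b + 1)))) :=
      ⟨hi, _, minusRefl _ _, hp, isMinus_minusRefl _ _, hE⟩
    obtain ⟨θ⟩ := (hpre.isProj hb).iso (isProj_proj Q k (v (b + 1)))
    exact hpre.of_iso θ

/-! ### Almost split factorisations -/

variable (Q v a) in
/-- Morphisms which factor through one of the immediate successors of the `a`-th term. -/
def factorSet (X Z : QRep Q k) : Set (X ⟶ Z) :=
  {φ | ∃ (c : ℕ) (E : QRep Q k) (f : X ⟶ E) (ψ : E ⟶ Z),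
    Q.Follows v a c ∧ IsPre c Q v E ∧ φ = f ≫ ψ}

theorem IsPre.mem_closure_factorSet [DecidableEq A] (H : SinkOrder Q h v) {X Z : QRep Q k}
    (hX : IsPre a Q v X) (φ : X ⟶ Z) (hφ : ¬ IsSplitMono φ) :
    φ ∈ AddSubmonoid.closure (factorSet Q v a X Z) := by
  induction a generalizing Q v h with
  | zero =>
    obtain ⟨hi, hX⟩ := hX
    have hr := (hX.isSplitMono_or hi φ).resolve_left hφ
    obtain ⟨h0, x, hx, hs⟩ := hX
    have huniv := IsSimpleAt.existsUnique_hom hi h0 hx hs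
    obtain ⟨w, hw⟩ := hr x
    let g (j : V) : (proj Q k j).sp j := (Finsupp.single .nil 1 : Q.Path j j →₀ k)
    choose f hf _ using fun α : {α : A // Q.t α = v 0} =>
      huniv (proj Q k (Q.s α)) ((proj Q k (Q.s α)).mapOf α.1 rfl α.2 (g _))
    choose ψ hψ _ using fun α : {α : A // Q.t α = v 0} =>
      isProj_proj_single Q k (Q.s α) Z (w α)
    have hsum : φ = ∑ α, f α ≫ ψ α := by
      refine (huniv Z _).unique rfl ?_
      rw [← hw, app_sum, inMap_apply]
      refine Finset.sum_congr rfl fun α _ => ?_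
      rw [app_comp, hf, app_mapOf, hψ]
    rw [hsum]
    refine AddSubmonoid.sum_mem _ fun α _ => AddSubmonoid.subset_closure ?_
    have hex : ∃ t, v t = Q.s α := (H.often (Q.s α) 0).imp fun _ h => h.2
    classical
    have hv := Nat.find_spec hex
    have hmin : ∀ c < Nat.find hex, v c ≠ v (Nat.find hex) := fun c hc h =>
      Nat.find_min hex hc (h.trans hv)
    refine ⟨Nat.find hex, proj Q k (Q.s α), f α, ψ α, ⟨?_, fun c _ hc => hmin c hc, ?_⟩, ?_, rfl⟩
    · refine Nat.pos_of_ne_zero fun h => hi α ?_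
      rw [← hv, h]
    · exact ⟨α, Or.inr ⟨hv.symm, α.2⟩⟩
    · have := isPre_proj (k := k) H hmin
      rwa [hv] at this
  | succ a ih =>
    obtain ⟨hi, X', R, hp, hm, hX'⟩ := hX
    set T := Z.reflPlusRefl hi
    have hT : T.IsPlus := Z.isPlus_reflPlusRefl hi
    obtain ⟨φ', hφ'⟩ := R.exists_match_right T φ
    have hns : ¬ IsSplitMono φ' := fun hs => hφ <| by
      obtain ⟨ρ, hρ⟩ := T.exists_match_left R (retraction φ')
      have := hφ'.comp hρ
      rw [IsSplitMono.id] at this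
      exact ⟨⟨⟨ρ, this.eq_left hm Refl.Match.id⟩⟩⟩
    have key : ∀ φ' ∈ AddSubmonoid.closure
        (factorSet (Q.reflect (v 0)) (fun t => v (t + 1)) a X' (Z.reflPlus hi)),
        ∃ ψ : X ⟶ Z, Refl.Match R T ψ φ' ∧
          ψ ∈ AddSubmonoid.closure (factorSet Q v (a + 1) X Z) := by
      intro φ' hφ'
      induction hφ' using AddSubmonoid.closure_induction with
      | zero => exact ⟨0, Refl.Match.zero, AddSubmonoid.zero_mem _⟩
      | add f' g' _ _ hf hg =>
        obtain ⟨f, hf, hf'⟩ := hf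
        obtain ⟨g, hg, hg'⟩ := hg
        exact ⟨f + g, hf.add hg, AddSubmonoid.add_mem _ hf' hg'⟩
      | mem φ' hφ' =>
        obtain ⟨c, E', f', ψ', hac, hE', rfl⟩ := hφ'
        have hE := isMinus_minusRefl hi E'
        rcases (minusRefl hi E').isPlus_or hE'.isBrick with hpl | hcon
        · obtain ⟨f, hf⟩ := R.exists_match_left (minusRefl hi E') f'
          obtain ⟨ψ, hψ⟩ := (minusRefl hi E').exists_match_left T ψ'
          exact ⟨f ≫ ψ, hf.comp hψ, AddSubmonoid.subset_closure
            ⟨c + 1, _, f, ψ, follows_succ.2 hac, ⟨hi, E', _, hpl, hE, hE'⟩, rfl⟩⟩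
        · refine ⟨0, ?_, AddSubmonoid.zero_mem _⟩
          rw [hT.hom_eq_zero hcon ψ', Limits.comp_zero]
          exact Refl.Match.zero
    obtain ⟨ψ, hψ, hmem⟩ := key φ' (ih H.next hX' φ' hns)
    rwa [hφ'.eq_left hm hψ]

/-- The space of morphisms from a term to an immediate successor is one dimensional, and its nonzero
elements factor only trivially. -/
theorem IsPre.hom_follows (H : SinkOrder Q h v) {X Y : QRep Q k} (hX : IsPre a Q v X)
    (hY : IsPre b Q v Y) (hab : Q.Follows v a b) :
    ∃ f : X ⟶ Y, f ≠ 0 ∧ (∀ φ : X ⟶ Y, ∃ c : k, φ = c • f) ∧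
      ∀ φ : X ⟶ Y, φ ≠ 0 → ∀ (Z : QRep Q k) (φ' : X ⟶ Z) (φ'' : Z ⟶ Y), φ = φ' ≫ φ'' →
        IsSplitMono φ' ∨ IsSplitEpi φ'' := by
  induction a generalizing Q h v b with
  | zero =>
    obtain ⟨h0, h1, α, hα⟩ := hab
    have hi : Q.IsSink (v 0) := H.sink 0
    have hα : Q.s α = v b ∧ Q.t α = v 0 := hα.resolve_left fun h => hi α h.1
    have hP : Y.IsProj (v b) := hY.isProj fun c hc => by
      rcases Nat.eq_zero_or_pos c with rfl | hc'
      · rw [← hα.1]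
        exact (hi α).symm
      · exact h1 c hc' hc
    rw [← hα.1] at hP
    exact hX.2.hom_isProj H.height H.simple hi hα.2 hP
  | succ a ih =>
    obtain ⟨b, rfl⟩ : ∃ b', b = b' + 1 := ⟨b - 1, by have := hab.1; omega⟩
    obtain ⟨hi, X', R, hp, hm, hX'⟩ := hX
    obtain ⟨_, Y', S, hp', hm', hY'⟩ := hY
    obtain ⟨f', hf0, hf1, hf2⟩ := ih H.next hX' hY' (follows_succ.1 hab)
    obtain ⟨f, hf⟩ := R.exists_match_left S f'
    refine ⟨f, ?_, fun φ => ?_, fun φ hφ0 Z φ₁ φ₂ hφ => ?_⟩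
    · rintro rfl
      exact hf0 (hf.eq_right hp' Refl.Match.zero)
    · obtain ⟨φ', hφ'⟩ := R.exists_match_right S φ
      obtain ⟨c, rfl⟩ := hf1 φ'
      exact ⟨c, hφ'.eq_left hm (hf.smul c)⟩
    · obtain ⟨φ₁', h₁⟩ := R.exists_match_right (Z.reflPlusRefl hi) φ₁
      obtain ⟨φ₂', h₂⟩ := (Z.reflPlusRefl hi).exists_match_right S φ₂
      have hφ' := h₁.comp h₂
      rw [← hφ] at hφ'
      have hne : φ₁' ≫ φ₂' ≠ 0 := fun h => hφ0 <| by
        rw [h] at hφ'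
        exact hφ'.eq_left hm Refl.Match.zero
      refine (hf2 _ hne _ φ₁' φ₂' rfl).imp (fun (hs : IsSplitMono φ₁') => ?_)
        fun (hs : IsSplitEpi φ₂') => ?_
      · obtain ⟨ρ, hρ⟩ := (Z.reflPlusRefl hi).exists_match_left R (retraction φ₁')
        have := h₁.comp hρ
        rw [IsSplitMono.id] at this
        exact ⟨⟨⟨ρ, this.eq_left hm Refl.Match.id⟩⟩⟩
      · obtain ⟨ρ, hρ⟩ := S.exists_match_left (Z.reflPlusRefl hi) (section_ φ₂')
        have := hρ.comp h₂
        rw [IsSplitEpi.id] at this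
        exact ⟨⟨⟨ρ, this.eq_left hm' Refl.Match.id⟩⟩⟩

end QRep

namespace QRep

variable {V A : Type} [DecidableEq V] [Fintype A] {k : Type u} [Field k]
  {Q : FinQuiver V A} {v : ℕ → V} {h : V → ℤ} {a b : ℕ} {X Y : QRep Q k}

/-! ### Irreducible morphisms -/

theorem IsPre.isIrreducible (H : SinkOrder Q h v) (hX : IsPre a Q v X) (hY : IsPre b Q v Y)
    (hab : Q.Follows v a b) {φ : X ⟶ Y} (hφ : φ ≠ 0) : IsIrreducible φ where
  not_splitMono := hX.not_isSplitMono hY hab.1 φ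
  not_splitEpi := hX.not_isSplitEpi hY hab.1 φ
  factor Z _ φ' φ'' hf := by
    obtain ⟨f, -, -, hirr⟩ := hX.hom_follows H hY hab
    exact hirr φ hφ Z φ' φ'' hf

theorem IsPre.follows_of_isIrreducible [DecidableEq A] (H : SinkOrder Q h v)
    (hX : IsPre a Q v X) (hY : IsPre b Q v Y) {φ : X ⟶ Y} (hφ : IsIrreducible φ) :
    Q.Follows v a b := by
  by_contra hab
  refine not_isIrreducible_of_mem_closure hX.isBrick hY.isBrick ?_ hX.finDim
    (hX.mem_closure_factorSet H φ hφ.not_splitMono) hφ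
  rintro _ ⟨c, E, f, ψ, hac, hE, rfl⟩
  refine ⟨E, f, ψ, hE.finDim, rfl, fun ρ => ?_, fun ρ => ?_⟩
  · rw [hE.hom_eq_zero hX hac.1 ρ, Limits.comp_zero]
  · rcases lt_trichotomy c b with hcb | rfl | hcb
    · rw [hY.hom_eq_zero hE hcb ρ, Limits.zero_comp]
    · exact absurd hac hab
    · rw [hE.hom_eq_zero hY hcb ψ, Limits.comp_zero]

theorem IsPre.exists_isIrreducible_iff [DecidableEq A] (H : SinkOrder Q h v)
    (hX : IsPre a Q v X) (hY : IsPre b Q v Y) :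
    (∃ φ : X ⟶ Y, IsIrreducible φ) ↔ Q.Follows v a b := by
  refine ⟨fun ⟨φ, hφ⟩ => hX.follows_of_isIrreducible H hY hφ, fun hab => ?_⟩
  obtain ⟨f, hf, -⟩ := hX.hom_follows H hY hab
  exact ⟨f, hX.isIrreducible H hY hab hf⟩

theorem IsPre.eq_smul_of_isIrreducible [DecidableEq A] (H : SinkOrder Q h v)
    (hX : IsPre a Q v X) (hY : IsPre b Q v Y) {φ : X ⟶ Y} (hφ : IsIrreducible φ)
    (φ' : X ⟶ Y) : ∃ c : k, φ' = c • φ := by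
  obtain ⟨f, -, hf, -⟩ := hX.hom_follows H hY (hX.follows_of_isIrreducible H hY hφ)
  obtain ⟨c, hc⟩ := hf φ
  obtain ⟨c', hc'⟩ := hf φ'
  have hc0 : c ≠ 0 := by
    rintro rfl
    exact hφ.ne_zero hX.isBrick hY.isBrick hX.finDim (by rw [hc, zero_smul])
  exact ⟨c' * c⁻¹, by rw [hc, hc', smul_smul, inv_mul_cancel_right₀ hc0]⟩

theorem IsPre.isSumOfIrrComp [DecidableEq A] (H : SinkOrder Q h v) (n : ℕ)
    (hX : IsPre a Q v X) (hY : IsPre b Q v Y) (hab : b = a + n + 1) (φ : X ⟶ Y) :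
    IsSumOfIrrComp φ := by
  induction n using Nat.strong_induction_on generalizing a X with
  | _ n ih =>
  refine AddSubmonoid.closure_le.2 ?_
    (hX.mem_closure_factorSet H φ (hX.not_isSplitMono hY (by omega) φ))
  rintro _ ⟨c, E, f, ψ, hac, hE, rfl⟩
  have zero_mem : IsSumOfIrrComp (0 : X ⟶ Y) := AddSubmonoid.zero_mem _
  by_cases h0 : f ≫ ψ = 0
  · rw [h0]; exact zero_mem
  rcases lt_trichotomy c b with hcb | rfl | hcb
  · have hf : f ≠ 0 := by
      rintro rfl
      exact h0 Limits.zero_comp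
    have := hac.1
    exact IsSumOfIrrComp.comp (.irr f hX.isIndec hE.isIndec (hX.isIrreducible H hE hac hf))
      (ih (b - c - 1) (by omega) hE (by omega) ψ)
  · exact AddSubmonoid.subset_closure
      (.irr _ hX.isIndec hY.isIndec (hX.isIrreducible H hY hac h0))
  · exact absurd (by rw [hE.hom_eq_zero hY hcb ψ, Limits.comp_zero]) h0

theorem IsPre.isSumOfIrrComp_of_not_isIso [DecidableEq A] (H : SinkOrder Q h v)
    (hX : IsPre a Q v X) (hY : IsPre b Q v Y) (φ : X ⟶ Y) (hφ : ¬ IsIso φ) :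
    IsSumOfIrrComp φ := by
  have zero_mem : IsSumOfIrrComp (0 : X ⟶ Y) := AddSubmonoid.zero_mem _
  rcases lt_trichotomy a b with hab | rfl | hab
  · exact hX.isSumOfIrrComp H (b - a - 1) hY (by omega) φ
  · rw [(hX.isIso_or_eq_zero hY φ).resolve_left hφ]
    exact zero_mem
  · rw [hX.hom_eq_zero hY hab φ]
    exact zero_mem

/-! ### Powers of the radical -/

theorem IsPre.level_lt [DecidableEq A] (H : SinkOrder Q h v) (n : ℕ)
    (hX : IsPre a Q v X) (hY : IsPre b Q v Y) (hab : b = a + n + 1) (φ : X ⟶ Y) (hφ : φ ≠ 0) :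
    level a h v < level b h v := by
  induction n using Nat.strong_induction_on generalizing a X with
  | _ n ih =>
  by_contra hlt
  have hmem : φ ∈ (⊥ : AddSubmonoid (X ⟶ Y)) := by
    refine AddSubmonoid.closure_le.2 ?_
      (hX.mem_closure_factorSet H φ (hX.not_isSplitMono hY (by omega) φ))
    rintro _ ⟨c, E, f, ψ, hac, hE, rfl⟩
    have hl := H.level_follows hac
    have hψ : ψ = 0 := by
      by_contra hψ
      rcases lt_trichotomy c b with hcb | rfl | hcb
      · have := hac.1
        have := ih (b - c - 1) (by omega) hE (by omega) ψ hψ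
        omega
      · omega
      · exact hψ (hE.hom_eq_zero hY hcb ψ)
    rw [hψ, Limits.comp_zero]
    exact AddSubmonoid.zero_mem _
  exact hφ hmem

theorem IsPre.level_le [DecidableEq A] (H : SinkOrder Q h v)
    (hX : IsPre a Q v X) (hY : IsPre b Q v Y) (φ : X ⟶ Y) (hφ : φ ≠ 0) :
    level a h v ≤ level b h v := by
  rcases lt_trichotomy a b with hab | rfl | hab
  · exact (hX.level_lt H (b - a - 1) hY (by omega) φ hφ).le
  · rfl
  · exact absurd (hX.hom_eq_zero hY hab φ) hφ

theorem IsPre.eq_zero_of_mem_radPow [DecidableEq A] (H : SinkOrder Q h v) (m : ℕ)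
    (hX : IsPre a Q v X) (hY : IsPre b Q v Y) (hm : level b h v < level a h v + m)
    {φ : X ⟶ Y} (hφ : φ ∈ radPow m X Y) : φ = 0 := by
  induction m generalizing a X with
  | zero =>
    by_contra h0
    have := hX.level_le H hY φ h0
    rw [Nat.cast_zero] at hm
    omega
  | succ m ih =>
    obtain ⟨Z, φ', φ'', -, h', h'', rfl⟩ := hφ
    have hcl := hX.mem_closure_factorSet H φ' (not_isSplitMono_of_mem_rad hX.isIndec h')
    clear h'
    induction hcl using AddSubmonoid.closure_induction with
    | zero => exact Limits.zero_comp
    | add f g _ _ hf hg => rw [Preadditive.add_comp, hf, hg, add_zero]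
    | mem f hf =>
      obtain ⟨c, E, f, ψ, hac, hE, rfl⟩ := hf
      have hl := H.level_follows hac
      have : ψ ≫ φ'' = 0 := ih hE (by push_cast at hm; omega) (comp_mem_radPow ψ h'')
      rw [Category.assoc, this, Limits.comp_zero]

/-- Finite direct sums of terms of level `d`. -/
inductive LevelSum (Q : FinQuiver V A) (h : V → ℤ) (v : ℕ → V) (d : ℤ) : QRep Q k → Prop
  | pre {X : QRep Q k} (a : ℕ) (hX : IsPre a Q v X) (hd : level a h v = d) : LevelSum Q h v d X
  | zero {X : QRep Q k} (hX : X.IsZeroRep) : LevelSum Q h v d X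
  | sum {X Y : QRep Q k} (hX : LevelSum Q h v d X) (hY : LevelSum Q h v d Y) :
      LevelSum Q h v d (X.sum Y)

variable {d : ℤ}

theorem LevelSum.finDim (hX : LevelSum Q h v d X) : X.FinDim := by
  induction hX with
  | pre a hX _ => exact hX.finDim
  | zero hX => exact fun j => by have := hX j; infer_instance
  | sum _ _ hX hY => exact hX.sum hY

theorem LevelSum.hom_eq_zero [DecidableEq A] (H : SinkOrder Q h v) {d' : ℤ}
    (hX : LevelSum Q h v d X) (hY : LevelSum Q h v d' Y) (hd : d' < d) (φ : X ⟶ Y) : φ = 0 := by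
  induction hX with
  | zero hX => exact hX.hom_from φ
  | @sum X₁ X₂ _ _ h₁ h₂ =>
    obtain ⟨ι₁, ι₂, π₁, π₂, h, -, -⟩ := isDirectSum_sum X₁ X₂
    rw [← Category.id_comp φ, ← h, Preadditive.add_comp, Category.assoc, Category.assoc,
      h₁ (ι₁ ≫ φ), h₂ (ι₂ ≫ φ)]
    simp
  | pre a hX ha =>
    induction hY with
    | zero hY =>
      refine hom_ext fun j x => ?_
      have := hY j
      exact Subsingleton.elim _ _
    | @sum Y₁ Y₂ _ _ h₁ h₂ =>
      obtain ⟨ι₁, ι₂, π₁, π₂, h, -, -⟩ := isDirectSum_sum Y₁ Y₂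
      rw [← Category.comp_id φ, ← h, Preadditive.comp_add, ← Category.assoc, ← Category.assoc,
        h₁ (φ ≫ π₁), h₂ (φ ≫ π₂)]
      simp
    | pre b hY hb =>
      by_contra h0
      have := hX.level_le H hY φ h0
      omega

theorem LevelSum.exists_factor [DecidableEq A] (H : SinkOrder Q h v)
    (hX : LevelSum Q h v d X) (hY : IsPre b Q v Y) (hd : d < level b h v) (φ : X ⟶ Y) :
    ∃ (Z : QRep Q k) (f : X ⟶ Z) (g : Z ⟶ Y), LevelSum Q h v (d + 1) Z ∧ φ = f ≫ g := by
  induction hX with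
  | zero hX =>
    exact ⟨_, 𝟙 _, φ, .zero hX, by simp⟩
  | @sum X₁ X₂ _ _ h₁ h₂ =>
    obtain ⟨ι₁, ι₂, π₁, π₂, hid, -, -⟩ := isDirectSum_sum X₁ X₂
    obtain ⟨Z₁, f₁, g₁, hZ₁, hφ₁⟩ := h₁ (ι₁ ≫ φ)
    obtain ⟨Z₂, f₂, g₂, hZ₂, hφ₂⟩ := h₂ (ι₂ ≫ φ)
    obtain ⟨f, g, hfg, -, -⟩ := exists_comp_eq_add (π₁ ≫ f₁) g₁ (π₂ ≫ f₂) g₂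
    refine ⟨_, f, g, .sum hZ₁ hZ₂, ?_⟩
    rw [hfg, Category.assoc, Category.assoc, ← hφ₁, ← hφ₂, ← Category.assoc, ← Category.assoc,
      ← Preadditive.add_comp, hid, Category.id_comp]
  | @pre X a hX ha =>
    have hns : ¬ IsSplitMono φ := by
      have hne : a ≠ b := by rintro rfl; omega
      rcases lt_or_gt_of_ne hne with hab | hab
      · exact hX.not_isSplitMono hY hab φ
      · intro hs
        apply hX.isBrick.id_ne_zero
        have h0 := hX.hom_eq_zero hY hab φ
        subst h0
        rw [← IsSplitMono.id (0 : X ⟶ Y)]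
        exact Limits.zero_comp
    have hcl := hX.mem_closure_factorSet H φ hns
    clear hns
    induction hcl using AddSubmonoid.closure_induction with
    | zero => exact ⟨zeroRep Q k, 0, 0, .zero (isZeroRep_zeroRep Q k), by simp⟩
    | add φ₁ φ₂ _ _ h₁ h₂ =>
      obtain ⟨Z₁, f₁, g₁, hZ₁, rfl⟩ := h₁
      obtain ⟨Z₂, f₂, g₂, hZ₂, rfl⟩ := h₂
      obtain ⟨f, g, hfg, -, -⟩ := exists_comp_eq_add f₁ g₁ f₂ g₂
      exact ⟨_, f, g, .sum hZ₁ hZ₂, hfg.symm⟩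
    | mem f hf =>
      obtain ⟨c, E, f, ψ, hac, hE, rfl⟩ := hf
      exact ⟨E, f, ψ, .pre c hE (by rw [H.level_follows hac, ha]), rfl⟩

theorem LevelSum.mem_radPow [DecidableEq A] (H : SinkOrder Q h v) (m : ℕ)
    (hX : LevelSum Q h v d X) (hY : IsPre b Q v Y) (hd : level b h v = d + m) (φ : X ⟶ Y) :
    φ ∈ radPow m X Y := by
  induction m generalizing d X with
  | zero => trivial
  | succ m ih =>
    push_cast at hd
    obtain ⟨Z, f, g, hZ, rfl⟩ := hX.exists_factor H hY (by omega) φ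
    exact ⟨Z, f, g, hZ.finDim, mem_rad_of_hom_eq_zero (fun ρ => hZ.hom_eq_zero H hX (by omega) ρ) f,
      ih hZ (by omega) g, rfl⟩

theorem IsPre.exists_radPow [DecidableEq A] (H : SinkOrder Q h v)
    (hX : IsPre a Q v X) (hY : IsPre b Q v Y) :
    ∃ d : ℕ, (∀ m ≤ d, radPow m X Y = Set.univ) ∧ radPow (d + 1) X Y = {0} := by
  have hzero : ∀ d, radPow d X Y = Set.univ → (0 : X ⟶ Y) ∈ radPow (d + 1) X Y := fun d hd =>
    ⟨X, 0, 0, hX.finDim, zero_mem_rad X X, by rw [hd]; trivial, by simp⟩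
  by_cases hne : ∃ φ : X ⟶ Y, φ ≠ 0
  · obtain ⟨φ, hφ⟩ := hne
    obtain ⟨d, hd⟩ := Int.le.dest (hX.level_le H hY φ hφ)
    have huniv : radPow d X Y = Set.univ := Set.eq_univ_of_forall fun ψ =>
      LevelSum.mem_radPow H d (.pre a hX rfl) hY hd.symm ψ
    refine ⟨d, fun m hm => Set.eq_univ_of_univ_subset ?_, Set.Subset.antisymm (fun ψ hψ => ?_) ?_⟩
    · rw [← huniv]
      exact radPow_antitone X Y hm
    · exact hX.eq_zero_of_mem_radPow H (d + 1) hY (by push_cast; omega) hψ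
    · rintro _ rfl
      exact hzero d huniv
  · push Not at hne
    refine ⟨0, fun m hm => ?_, Set.Subset.antisymm (fun ψ _ => hne ψ) ?_⟩
    · obtain rfl : m = 0 := by omega
      rfl
    · rintro _ rfl
      exact hzero 0 rfl

end QRep

/-! ### Dynkin quivers are graded -/

theorem IsDynkinDiagram.smaller_unique {n : ℕ} {Γ : SimpleGraph (Fin n)}
    (hΓ : IsDynkinDiagram n Γ) {x y z : Fin n} (hy : Γ.Adj y x) (hz : Γ.Adj z x) (hyx : y < x)
    (hzx : z < x) : y = z := by
  have fork : ∀ (n b : ℕ) (x y z : Fin n), (forkGraph n b).Adj y x → (forkGraph n b).Adj z x →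
      y < x → z < x → y = z := by
    intro n b x y z hy hz hyx hzx
    simp only [forkGraph, SimpleGraph.fromRel_adj] at hy hz
    rw [Fin.lt_def] at hyx hzx
    rw [Fin.ext_iff]
    omega
  cases hΓ with
  | A n hn =>
    rw [SimpleGraph.pathGraph_adj] at hy hz
    rw [Fin.lt_def] at hyx hzx
    rw [Fin.ext_iff]
    omega
  | D n hn => exact fork _ _ _ _ _ hy hz hyx hzx
  | E6 => exact fork _ _ _ _ _ hy hz hyx hzx
  | E7 => exact fork _ _ _ _ _ hy hz hyx hzx
  | E8 => exact fork _ _ _ _ _ hy hz hyx hzx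

namespace FinQuiver

variable {V A : Type}

theorem IsDynkin.exists_height {Q : FinQuiver V A} (hQ : Q.IsDynkin) :
    ∃ h : V → ℤ, ∀ α, h (Q.s α) = h (Q.t α) + 1 := by
  classical
  obtain ⟨n, Γ, e, hΓ, hadj, huniq⟩ := hQ
  have key : ∀ m : ℕ, ∃ h : V → ℤ, ∀ α, (e (Q.s α) : ℕ) < m → (e (Q.t α) : ℕ) < m →
      h (Q.s α) = h (Q.t α) + 1 := by
    intro m
    induction m with
    | zero => exact ⟨0, fun α h => by omega⟩
    | succ m ih =>
      obtain ⟨h, hh⟩ := ih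
      by_cases hex : ∃ α, ((e (Q.s α) : ℕ) = m ∧ (e (Q.t α) : ℕ) < m) ∨
          ((e (Q.t α) : ℕ) = m ∧ (e (Q.s α) : ℕ) < m)
      · obtain ⟨α, hα⟩ := hex
        obtain ⟨w, u, c, hw, hu, hadjα, hαc⟩ : ∃ (w u : V) (c : ℤ), (e w : ℕ) = m ∧ (e u : ℕ) < m ∧
            ((Q.s α = w ∧ Q.t α = u) ∨ (Q.s α = u ∧ Q.t α = w)) ∧
            ((Q.s α = w → c = h u + 1) ∧ (Q.t α = w → c = h u - 1)) := by
          rcases hα with ⟨h1, h2⟩ | ⟨h1, h2⟩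
          · exact ⟨Q.s α, Q.t α, h (Q.t α) + 1, h1, h2, Or.inl ⟨rfl, rfl⟩, fun _ => rfl,
              fun h3 => by rw [h3] at h2; omega⟩
          · exact ⟨Q.t α, Q.s α, h (Q.s α) - 1, h1, h2, Or.inr ⟨rfl, rfl⟩,
              fun h3 => by rw [h3] at h2; omega, fun _ => rfl⟩
        have hΓwu : Γ.Adj (e u) (e w) := by
          have := hadj α
          rcases hadjα with ⟨h1, h2⟩ | ⟨h1, h2⟩
          · rw [h1, h2] at this; exact this.symm
          · rw [h1, h2] at this; exact this
        have huw : u ≠ w := by rintro rfl; omega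
        refine ⟨Function.update h w c, fun β hs ht => ?_⟩
        have hβ := hadj β
        by_cases hsw : Q.s β = w
        · have htw : Q.t β ≠ w := fun h => hβ.ne (by rw [hsw, h])
          have htm : (e (Q.t β) : ℕ) ≠ m := fun h => htw (e.injective (Fin.ext (h.trans hw.symm)))
          have htu : Q.t β = u := e.injective (hΓ.smaller_unique (x := e w)
            (by rw [hsw] at hβ; exact hβ.symm) hΓwu (by rw [Fin.lt_def]; omega)
            (by rw [Fin.lt_def]; omega))
          have : β = α := (huniq w u hΓwu.symm).unique (Or.inl ⟨hsw, htu⟩) hadjα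
          subst this
          rw [hsw, htu, Function.update_self, Function.update_of_ne huw, hαc.1 hsw]
        · have hsm : (e (Q.s β) : ℕ) ≠ m := fun h => hsw (e.injective (Fin.ext (h.trans hw.symm)))
          by_cases htw : Q.t β = w
          · have hsu : Q.s β = u := e.injective (hΓ.smaller_unique (x := e w)
              (by rw [htw] at hβ; exact hβ) hΓwu (by rw [Fin.lt_def]; omega)
              (by rw [Fin.lt_def]; omega))
            have : β = α := (huniq w u hΓwu.symm).unique (Or.inr ⟨hsu, htw⟩) hadjα
            subst this
            rw [htw, hsu, Function.update_self, Function.update_of_ne huw, hαc.2 htw]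
            ring
          · have htm : (e (Q.t β) : ℕ) ≠ m := fun h =>
              htw (e.injective (Fin.ext (h.trans hw.symm)))
            rw [Function.update_of_ne hsw, Function.update_of_ne htw]
            exact hh β (by omega) (by omega)
      · push Not at hex
        refine ⟨h, fun β hs ht => ?_⟩
        have hβ := (hadj β).ne
        rw [Ne, Fin.ext_iff] at hβ
        have := hex β
        exact hh β (by omega) (by omega)
  obtain ⟨h, hh⟩ := key n
  exact ⟨h, fun α => hh α (e _).2 (e _).2⟩

theorem IsDynkin.arrow_unique {Q : FinQuiver V A} (hQ : Q.IsDynkin) (α β : A)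
    (hs : Q.s α = Q.s β) (ht : Q.t α = Q.t β) : α = β := by
  obtain ⟨n, Γ, e, hΓ, hadj, huniq⟩ := hQ
  exact (huniq _ _ (hadj α)).unique (Or.inl ⟨rfl, rfl⟩) (Or.inl ⟨hs.symm, ht.symm⟩)

/-! ### Periodic sequences of sinks -/

/-- The periodic sequence which repeats the list `L`. -/
def cycle (L : List V) (hL : 0 < L.length) (t : ℕ) : V := L[t % L.length]'(Nat.mod_lt _ hL)

theorem cycle_of_lt {L : List V} (hL : 0 < L.length) {t : ℕ} (ht : t < L.length) :
    cycle L hL t = L[t] := by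
  simp [cycle, Nat.mod_eq_of_lt ht]

theorem cycle_add_length {L : List V} (hL : 0 < L.length) (t : ℕ) :
    cycle L hL (t + L.length) = cycle L hL t := by
  simp [cycle]

theorem cycle_add_mul {L : List V} (hL : 0 < L.length) (m t : ℕ) (ht : t < L.length) :
    cycle L hL (m * L.length + t) = L[t] := by
  simp [cycle, Nat.mod_eq_of_lt ht]

theorem cycle_inj {L : List V} (hL : 0 < L.length) (hd : L.Nodup) {t t' : ℕ}
    (h : cycle L hL t = cycle L hL t') : t % L.length = t' % L.length :=
  (hd.getElem_inj_iff).1 h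

variable [DecidableEq V] {Q : FinQuiver V A}

theorem seqQuiver_add_length (L : List V) (Q : FinQuiver V A) (w : ℕ → V)
    (hw : ∀ (t : ℕ) (ht : t < L.length), w t = L[t]) (t : ℕ) :
    seqQuiver (t + L.length) Q w = seqQuiver t (Q.reflectList L) fun s => w (s + L.length) := by
  induction L generalizing Q w with
  | nil => rfl
  | cons i L ih =>
    have h0 : w 0 = i := hw 0 (by simp)
    have := ih (Q.reflect i) (fun s => w (s + 1)) fun t ht =>
      hw (t + 1) (by simpa using ht)
    rw [List.length_cons, ← add_assoc, seqQuiver, h0, this, reflectList]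
    rfl

theorem SinkSequence.isSink {L : List V} {Q : FinQuiver V A} (hQ : Q.SinkSequence L) (w : ℕ → V)
    (hw : ∀ (t : ℕ) (ht : t < L.length), w t = L[t]) (t : ℕ) (ht : t < L.length) :
    (seqQuiver t Q w).IsSink (w t) := by
  induction L generalizing Q w t with
  | nil => simp at ht
  | cons i L ih =>
    have h0 : w 0 = i := hw 0 (by simp)
    cases t with
    | zero => rw [h0]; exact hQ.1
    | succ t =>
      rw [seqQuiver, h0]
      exact ih hQ.2 (fun s => w (s + 1)) (fun t ht => hw (t + 1) (by simpa using ht)) t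
        (by simpa using ht)

theorem IsAdmissible.sinkOrder {L : List V} (hL : Q.IsAdmissible L) (hlen : 0 < L.length)
    {h : V → ℤ} (hh : ∀ α, h (Q.s α) = h (Q.t α) + 1)
    (hsimple : ∀ α β, Q.s α = Q.s β → Q.t α = Q.t β → α = β) :
    SinkOrder Q h (cycle L hlen) where
  height := hh
  simple := hsimple
  sink t := by
    induction t using Nat.strong_induction_on with
    | _ t ih =>
    by_cases ht : t < L.length
    · exact hL.sinks.isSink _ (fun t ht => cycle_of_lt hlen ht) t ht
    · obtain ⟨t, rfl⟩ : ∃ t', t = t' + L.length := ⟨t - L.length, by omega⟩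
      rw [seqQuiver_add_length L Q _ fun t ht => cycle_of_lt hlen ht, hL.reflectList_eq]
      simp only [cycle_add_length]
      exact ih t (by omega)
  often j N := by
    refine ⟨N * L.length + L.idxOf j, ?_, ?_⟩
    · have := Nat.le_mul_of_pos_right N hlen
      omega
    · rw [cycle_add_mul hlen N _ (List.idxOf_lt_length_iff.2 (hL.mem j)), List.getElem_idxOf]

theorem SinkSequence.idxOf_lt {L : List V} {Q : FinQuiver V A} (hQ : Q.SinkSequence L) (α : A)
    (ht : Q.t α ∈ L) : L.idxOf (Q.t α) < L.idxOf (Q.s α) := by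
  induction L generalizing Q with
  | nil => simp at ht
  | cons i L ih =>
    by_cases hα : Q.t α = i
    · rw [hα, List.idxOf_cons_self, List.idxOf_cons_ne _ (hQ.1 α).symm]
      omega
    · have := ih hQ.2 (by
        rw [hQ.1.reflect_t_of_ne hα]
        exact (List.mem_cons.1 ht).resolve_left hα)
      rw [hQ.1.reflect_t_of_ne hα, hQ.1.reflect_s_of_ne hα] at this
      rw [List.idxOf_cons_ne _ (Ne.symm hα), List.idxOf_cons_ne _ (hQ.1 α).symm]
      omega

theorem IsAdmissible.follows_iff {L : List V} (hL : Q.IsAdmissible L) (hlen : 0 < L.length)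
    (i j : V) (m m' : ℕ) :
    Q.Follows (cycle L hlen) (m * L.length + L.idxOf i) (m' * L.length + L.idxOf j) ↔
      (m = m' ∧ ∃ α, Q.s α = j ∧ Q.t α = i) ∨ (m' = m + 1 ∧ ∃ α, Q.s α = i ∧ Q.t α = j) := by
  have hi : L.idxOf i < L.length := List.idxOf_lt_length_iff.2 (hL.mem i)
  have hj : L.idxOf j < L.length := List.idxOf_lt_length_iff.2 (hL.mem j)
  have hvi : ∀ m, cycle L hlen (m * L.length + L.idxOf i) = i := fun m => by
    rw [cycle_add_mul hlen m _ hi, List.getElem_idxOf]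
  have hvj : ∀ m, cycle L hlen (m * L.length + L.idxOf j) = j := fun m => by
    rw [cycle_add_mul hlen m _ hj, List.getElem_idxOf]
  have horder : ∀ α, L.idxOf (Q.t α) < L.idxOf (Q.s α) := fun α =>
    hL.sinks.idxOf_lt α (hL.mem _)
  have hgap : ∀ c, c < m' * L.length + L.idxOf j → cycle L hlen c = j →
      c + L.length ≤ m' * L.length + L.idxOf j := fun c hc hcj => by
    have h1 := cycle_inj hlen hL.nodup (hcj.trans (hvj m').symm)
    have h2 := (Nat.modEq_iff_dvd' hc.le).1 h1
    have := Nat.le_of_dvd (by omega) h2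
    omega
  rw [Follows, hvi, hvj]
  constructor
  · rintro ⟨hlt, hno, α, ⟨hs, ht⟩ | ⟨hs, ht⟩⟩
    · have ho := horder α
      rw [hs, ht] at ho
      refine Or.inr ⟨?_, α, hs, ht⟩
      rcases lt_trichotomy m' (m + 1) with hm | hm | hm
      · have := Nat.mul_le_mul_right L.length (show m' ≤ m by omega)
        omega
      · exact hm
      · exfalso
        obtain ⟨d, rfl⟩ : ∃ d, m' = d + 1 := ⟨m' - 1, by omega⟩
        have h1 := Nat.mul_le_mul_right L.length (show m + 1 ≤ d by omega)
        rw [add_mul, one_mul] at h1 hlt hno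
        exact hno (d * L.length + L.idxOf j) (by omega) (by omega) (hvj d)
    · have ho := horder α
      rw [hs, ht] at ho
      refine Or.inl ⟨?_, α, hs, ht⟩
      rcases lt_trichotomy m m' with hm | hm | hm
      · exfalso
        obtain ⟨d, rfl⟩ : ∃ d, m' = d + 1 := ⟨m' - 1, by omega⟩
        have h1 := Nat.mul_le_mul_right L.length (show m ≤ d by omega)
        rw [add_mul, one_mul] at hlt hno
        exact hno (d * L.length + L.idxOf j) (by omega) (by omega) (hvj d)
      · exact hm
      · have h1 := Nat.mul_le_mul_right L.length (show m' + 1 ≤ m by omega)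
        rw [add_mul, one_mul] at h1
        omega
  · rintro (⟨rfl, α, hs, ht⟩ | ⟨rfl, α, hs, ht⟩)
    · have ho := horder α
      rw [hs, ht] at ho
      refine ⟨by omega, fun c hc hc' hcj => ?_, α, Or.inr ⟨hs, ht⟩⟩
      have := hgap c hc' hcj
      omega
    · have ho := horder α
      rw [hs, ht] at ho
      rw [add_mul, one_mul] at hgap ⊢
      refine ⟨by omega, fun c hc hc' hcj => ?_, α, Or.inl ⟨hs, ht⟩⟩
      have := hgap c hc' hcj
      omega

end FinQuiver

open FinQuiver

namespace QRep

variable {V A : Type} [DecidableEq V] [Fintype A] {k : Type u} [Field k]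
  {Q : FinQuiver V A}

/-! ### Coxeter functors -/

theorem IsZeroRep.plusAlong {L : List V} {Q : FinQuiver V A} (hs : Q.SinkSequence L)
    {X : QRep Q k} (hX : X.IsZeroRep) : (QRep.plusAlong L Q hs X).IsZeroRep := by
  induction L generalizing Q with
  | nil => exact hX
  | cons i L ih => exact ih hs.2 ((X.isPlus_reflPlusRefl hs.1).isZeroRep hX)

theorem IsProj.isZeroRep_reflPlus {i : V} (hi : Q.IsSink i) {X : QRep Q k} (hX : X.IsProj i) :
    (X.reflPlus hi).IsZeroRep := by
  obtain ⟨θ⟩ := (isProj_proj Q k i).iso hX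
  have h := ((isSimpleAt_proj hi).of_iso θ).1
  intro j
  by_cases hj : j = i
  · subst hj
    have : ∀ α : {α : A // Q.t α = j}, Subsingleton (X.sp (Q.s α)) := fun α => h _ (hi α)
    exact (X.isPlus_reflPlusRefl hi).subsingleton
  · have := h j hj
    exact ((X.reflPlusRefl hi).e j hj).symm.injective.subsingleton

theorem IsZeroRep.coxPlus_iterate {L : List V} (hL : Q.IsAdmissible L) (n : ℕ) {X : QRep Q k}
    (hX : X.IsZeroRep) : ((coxPlus hL)^[n] X).IsZeroRep := by
  induction n generalizing X with
  | zero => exact hX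
  | succ n ih => exact ih (hX.plusAlong hL.sinks : (coxPlus hL X).IsZeroRep)

theorem IsPre.ofEq {Q' : FinQuiver V A} (e : Q = Q') {a : ℕ} {v : ℕ → V} {X : QRep Q k}
    (hX : IsPre a Q v X) : IsPre a Q' v (X.ofEq e) := by
  subst e
  exact hX

variable [DecidableEq A]

theorem IsProj.reflPlus {i j : V} (hi : Q.IsSink i) (hj : j ≠ i) {X : QRep Q k}
    (hX : X.IsProj j) : (X.reflPlus hi).IsProj j := by
  have hm := isMinus_minusRefl hi (proj (Q.reflect i) k j)
  obtain ⟨θ⟩ := (hm.isProj hj (isProj_proj _ k j)).iso hX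
  have hp := (isPlus_minusRefl_proj (k := k) hi hj).ofIso θ
  have hp' := X.isPlus_reflPlusRefl hi
  obtain ⟨φ, hφ⟩ := ((minusRefl hi (proj (Q.reflect i) k j)).ofIso θ).exists_match_right
    (X.reflPlusRefl hi) (𝟙 X)
  obtain ⟨ψ, hψ⟩ := (X.reflPlusRefl hi).exists_match_right
    ((minusRefl hi (proj (Q.reflect i) k j)).ofIso θ) (𝟙 X)
  have h₁ := hφ.comp hψ
  have h₂ := hψ.comp hφ
  rw [Category.comp_id] at h₁ h₂
  exact (isProj_proj _ k j).of_iso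
    ⟨φ, ψ, h₁.eq_right hp Refl.Match.id, h₂.eq_right hp' Refl.Match.id⟩

theorem IsProj.isZeroRep_plusAlong {L : List V} {Q : FinQuiver V A} (hs : Q.SinkSequence L)
    {X : QRep Q k} {j : V} (hj : j ∈ L) (hX : X.IsProj j) :
    (QRep.plusAlong L Q hs X).IsZeroRep := by
  induction L generalizing Q with
  | nil => simp at hj
  | cons i L ih =>
    by_cases h : j = i
    · subst h
      exact (hX.isZeroRep_reflPlus hs.1).plusAlong hs.2
    · exact ih hs.2 ((List.mem_cons.1 hj).resolve_left h) (hX.reflPlus hs.1 h)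

theorem IsPre.minusAlong {L : List V} {Q : FinQuiver V A} (hs : Q.SinkSequence L) {a : ℕ}
    {w : ℕ → V} (hw : ∀ (t : ℕ) (ht : t < L.length), w t = L[t])
    {X : QRep (Q.reflectList L) k}
    (hX : IsPre a (Q.reflectList L) (fun t => w (t + L.length)) X)
    (h0 : ¬ (QRep.minusAlong L Q hs X).IsZeroRep) :
    IsPre (a + L.length) Q w (QRep.minusAlong L Q hs X) := by
  induction L generalizing Q w with
  | nil => exact hX
  | cons i L ih =>
    obtain rfl : w 0 = i := hw 0 (by simp)
    have hm := isMinus_minusRefl hs.1 (QRep.minusAlong L (Q.reflect (w 0)) hs.2 X)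
    have h1 : ¬ (QRep.minusAlong L (Q.reflect (w 0)) hs.2 X).IsZeroRep := fun hz =>
      h0 (hm.isZeroRep fun j _ => hz j)
    have hpre := ih hs.2 (w := fun t => w (t + 1)) (fun t ht => hw (t + 1) (by simpa using ht))
      hX h1
    have hp := ((minusRefl hs.1 _).isPlus_or hpre.isBrick).resolve_right fun hc =>
      h0 (hm.isZeroRep hc)
    exact ⟨hs.1, _, minusRefl hs.1 _, hp, hm, hpre⟩

theorem IsZeroRep.minusAlong {L : List V} {Q : FinQuiver V A} (hs : Q.SinkSequence L)
    {X : QRep (Q.reflectList L) k} (hX : X.IsZeroRep) :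
    (QRep.minusAlong L Q hs X).IsZeroRep := by
  induction L generalizing Q with
  | nil => exact hX
  | cons i L ih =>
    exact (isMinus_minusRefl hs.1 (QRep.minusAlong L (Q.reflect i) hs.2 X)).isZeroRep
      fun j _ => ih hs.2 hX j

theorem IsPre.coxMinus {L : List V} (hL : Q.IsAdmissible L) (hlen : 0 < L.length) {a : ℕ}
    {X : QRep Q k} (hX : IsPre a Q (cycle L hlen) X) (h0 : ¬ (QRep.coxMinus hL X).IsZeroRep) :
    IsPre (a + L.length) Q (cycle L hlen) (QRep.coxMinus hL X) := by
  refine IsPre.minusAlong hL.sinks (fun t ht => cycle_of_lt hlen ht) ?_ h0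
  simp only [cycle_add_length]
  exact hX.ofEq hL.reflectList_eq.symm

theorem IsPre.coxMinus_iterate {L : List V} (hL : Q.IsAdmissible L) (hlen : 0 < L.length) {a : ℕ}
    {X : QRep Q k} (hX : IsPre a Q (cycle L hlen) X) (m : ℕ)
    (h0 : ¬ ((QRep.coxMinus hL)^[m] X).IsZeroRep) :
    IsPre (m * L.length + a) Q (cycle L hlen) ((QRep.coxMinus hL)^[m] X) := by
  induction m with
  | zero => simpa using hX
  | succ m ih =>
    rw [Function.iterate_succ_apply'] at h0 ⊢
    have h1 : ¬ ((QRep.coxMinus hL)^[m] X).IsZeroRep := fun hz =>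
      h0 (IsZeroRep.minusAlong hL.sinks
        (hz : (((QRep.coxMinus hL)^[m] X).ofEq hL.reflectList_eq.symm).IsZeroRep))
    have := (ih h1).coxMinus hL hlen h0
    rwa [show (m + 1) * L.length + a = m * L.length + a + L.length by ring]

theorem exists_isPre {L : List V} (hL : Q.IsAdmissible L) (hlen : 0 < L.length) {h : V → ℤ}
    (H : SinkOrder Q h (cycle L hlen)) {X : QRep Q k} (hX : X.IsIndec) (i : V) (r : ℤ)
    (θ : X ≅ coxPow hL r (proj Q k i)) :
    ∃ m : ℕ, r = -m ∧ IsPre (m * L.length + L.idxOf i) Q (cycle L hlen) X := by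
  have hi : L.idxOf i < L.length := List.idxOf_lt_length_iff.2 (hL.mem i)
  have hvi : cycle L hlen (L.idxOf i) = i := by
    rw [cycle_of_lt hlen hi, List.getElem_idxOf]
  have hP : IsPre (L.idxOf i) Q (cycle L hlen) (proj Q k i) := by
    have := isPre_proj (k := k) H (b := L.idxOf i) fun c hc hci => by
      have := cycle_inj hlen hL.nodup hci
      rw [Nat.mod_eq_of_lt hi, Nat.mod_eq_of_lt (hc.trans hi)] at this
      omega
    rwa [hvi] at this
  have hne : ¬ (coxPow hL r (proj Q k i)).IsZeroRep := fun hz => hX.nonzero (hz.of_iso θ.symm)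
  match r, θ, hne with
  | .ofNat 0, θ, hne => exact ⟨0, by simp, by simpa using hP.of_iso θ.symm⟩
  | .ofNat (n + 1), θ, hne =>
    exact absurd (IsZeroRep.coxPlus_iterate hL n
      ((isProj_proj Q k i).isZeroRep_plusAlong hL.sinks (hL.mem i) :
        (coxPlus hL (proj Q k i)).IsZeroRep)) hne
  | .negSucc n, θ, hne =>
    exact ⟨n + 1, by rw [Int.negSucc_eq]; push_cast; rfl,
      (hP.coxMinus_iterate hL hlen (n + 1) hne).of_iso θ.symm⟩

end QRep

end

end QuivRep

open CategoryTheory in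
theorem mainTheorem8 {V A : Type} [Fintype V] [DecidableEq V] [Fintype A] [DecidableEq A]
    {k : Type*} [Field k] (Q : QuivRep.FinQuiver V A) (hQ : Q.IsDynkin)
    {L : List V} (hL : Q.IsAdmissible L)
    (X Y : QuivRep.QRep Q k) (hX : X.IsIndec) (hY : Y.IsIndec)
    (i j : V) (r s : ℤ)
    (eX : Nonempty (X ≅ QuivRep.QRep.coxPow hL r (QuivRep.QRep.proj Q k i)))
    (eY : Nonempty (Y ≅ QuivRep.QRep.coxPow hL s (QuivRep.QRep.proj Q k j))) :
    (Nonempty (End X ≃ₐ[k] k) ∧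
      ∀ φ : X ⟶ Y, ¬ IsIso φ → QuivRep.QRep.IsSumOfIrrComp φ) ∧
    (((∃ φ : X ⟶ Y, QuivRep.QRep.IsIrreducible φ) ↔
        (r = s ∧ ∃ α, Q.s α = j ∧ Q.t α = i) ∨ (r = s + 1 ∧ ∃ α, Q.s α = i ∧ Q.t α = j)) ∧
      ∀ φ φ' : X ⟶ Y, QuivRep.QRep.IsIrreducible φ → QuivRep.QRep.IsIrreducible φ' →
        ∃ c : k, φ' = c • φ) ∧
    ∃ d : ℕ, (∀ m ≤ d, QuivRep.QRep.radPow m X Y = Set.univ) ∧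
      QuivRep.QRep.radPow (d + 1) X Y = {0} := by
  obtain ⟨h, hh⟩ := hQ.exists_height
  have hlen : 0 < L.length := List.length_pos_of_mem (hL.mem i)
  have H := hL.sinkOrder hlen hh hQ.arrow_unique
  obtain ⟨m, hr, hX'⟩ := QuivRep.QRep.exists_isPre hL hlen H hX i r eX.some
  obtain ⟨m', hs, hY'⟩ := QuivRep.QRep.exists_isPre hL hlen H hY j s eY.some
  refine ⟨⟨hX'.isBrick.nonempty_algEquiv, hX'.isSumOfIrrComp_of_not_isIso H hY'⟩, ⟨?_, ?_⟩,
    hX'.exists_radPow H hY'⟩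
  · rw [hX'.exists_isIrreducible_iff H hY', hL.follows_iff hlen,
      show r = s ↔ m = m' by omega, show r = s + 1 ↔ m' = m + 1 by omega]
  · exact fun φ φ' hφ _ => hX'.eq_smul_of_isIrreducible H hY' hφ φ'
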